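/- Let $n\ge 1$, $d=n+1$, $m\ge 0$, $\omega_{\mathbf p}=\sqrt{|\mathbf p|^2+m^2}$, and let $\mathscr H_1=L^2(\mathbb R^n,\frac{d^n\mathbf p}{2\omega_{\mathbf p}};\mathbb C)$ be the one-particle space of the free scalar field of mass $m$. Let $\mathcal F=\bigoplus_{k\ge 0}\mathscr H_1^{\otimes k}$ be the Fock space, with $\mathscr H_1^{\otimes k}=L^2((\mathbb R^n)^k)$ with respect to the product measure, and let $P^\mu$, $\mu=0,\dots,n$, be the momentum operators on $\mathcal F$, acting on the $k$-particle component as multiplication by $\sum_{j=1}^k p_j^\mu$, where $p_j^0=\omega_{\mathbf p_j}$, on the maximal domain. Let $\Delta(P)$ be the space of $f\in\mathscr H_1$ such that $|\mathbf p|^{2r}|f(\mathbf p)|$ is (essentially) bounded for every $r=0,1,2,\dots$, and let $\Delta_k(P)=\Delta(P)^{\otimes k}\subset\mathscr H_1^{\otimes k}$ be the algebraic tensor power. For a unitary operator $V:\mathscr H_1\to\mathscr H_1$ put $\Gamma(V)=\bigoplus_{k\ge 0}V^{\otimes k}$, $X^\mu=\Gamma(V^{-1})P^\mu\Gamma(V)$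 and $\Delta_k(X)=\Gamma(V^{-1})\Delta_k(P)$. Let $(\mathscr K,D)$ be any one of the following pairs of a Hilbert space and a subspace: $(\mathscr H_1^{\otimes k},\Delta_k(X))$ with $k\ge 0$; $(\mathcal F,D_{\mathcal F})$, where $D_{\mathcal F}$ consists of all finite sums of vectors from the $\Delta_k(X)$, $k\ge 0$; or the corresponding bosonic pair, in which $\mathscr K$ is replaced by its subspace of totally symmetric vectors and $D$ by its intersection with that subspace. Then the following holds for the restrictions of the operators $X^\mu$ to $D$, as operators in $\mathscr K$. 1. $D$ is dense in $\mathscr K$ and contained in the domain of every $X^\mu$, $X^\mu D\subset D$, and every $X^\mu$ is essentially self-adjoint on $D$. 2. The components commute: $[X^\mu,X^\nu]\psi=0$ for all $\psi\in D$ and all $\mu,\nu$. 3. For every $p\in\mathbb R^d$ the operator $p\cdot X=\sum_\mu p_\mu X^\mu$ is essentially self-adjoint on $D$. Hence there is a unique unitary operator $U(p)=e^{ip\cdot X}$, the value at time $1$ of the strongly continuous one-parameter unitary group whose generator is the closure of $(p\cdot X)|_D$. Moreover $U(0)=1$ and $U(p+q)=U(p)U(q)$ for all $p,q\in\mathbb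 R^d$, and $p\mapsto U(p)\psi$ is continuous for every $\psi\in\mathscr K$: $U$ is a strongly continuous unitary representation of $\mathbb R^d$. -/

import Mathlib

open MeasureTheory Filter Topology
open scoped ENNReal InnerProductSpace

noncomputable section

namespace WarpedQFT

/-! ### Unbounded operators -/

section Operators

variable {H : Type*} [NormedAddCommGroup H] [InnerProductSpace ℂ H]

/-- A densely defined operator is essentially self-adjoint if it is closable and its closure is
self-adjoint. -/
def IsEssentiallySelfAdjoint [CompleteSpace H] (A : H →ₗ.[ℂ] H) : Prop :=
  Dense (A.domain : Set H) ∧ A.IsClosable ∧ IsSelfAdjoint A.closure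

/-- The operator `W' A W` on its natural domain `{ψ | W ψ ∈ dom A}`. -/
def sandwich (W' : H ≃ₗᵢ[ℂ] H) (A : H →ₗ.[ℂ] H) (W : H ≃ₗᵢ[ℂ] H) : H →ₗ.[ℂ] H where
  domain := A.domain.comap W.toLinearEquiv.toLinearMap
  toFun :=
    { toFun := fun ψ => W' (A ⟨W ψ, ψ.2⟩)
      map_add' := by
        intro x y
        rw [← map_add, ← LinearPMap.map_add]
        congr 2
        ext
        simp
      map_smul' := by
        intro c x
        rw [RingHom.id_apply, ← map_smul, ← LinearPMap.map_smul]
        congr 2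
        ext
        simp }

/-- The part of `A` in the subspace `K`: it acts as `A` on all `ψ ∈ K ∩ dom A` with `A ψ ∈ K`. -/
def part (A : H →ₗ.[ℂ] H) (K : Submodule ℂ H) : K →ₗ.[ℂ] K where
  domain :=
    { carrier := {ψ | ∃ h : (ψ : H) ∈ A.domain, A ⟨ψ, h⟩ ∈ K}
      zero_mem' := ⟨A.domain.zero_mem, by
        have : A ⟨((0 : K) : H), A.domain.zero_mem⟩ = 0 := A.map_zero
        rw [this]; exact K.zero_mem⟩
      add_mem' := by
        rintro x y ⟨hx, hx'⟩ ⟨hy, hy'⟩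
        refine ⟨A.domain.add_mem hx hy, ?_⟩
        have : A ⟨((x + y : K) : H), A.domain.add_mem hx hy⟩ = A ⟨x, hx⟩ + A ⟨y, hy⟩ :=
          A.map_add ⟨x, hx⟩ ⟨y, hy⟩
        rw [this]; exact K.add_mem hx' hy'
      smul_mem' := by
        rintro c x ⟨hx, hx'⟩
        refine ⟨A.domain.smul_mem c hx, ?_⟩
        have : A ⟨((c • x : K) : H), A.domain.smul_mem c hx⟩ = c • A ⟨x, hx⟩ :=
          A.map_smul c ⟨x, hx⟩
        rw [this]; exact K.smul_mem c hx' }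
  toFun :=
    { toFun := fun ψ => ⟨A ⟨ψ.1, ψ.2.1⟩, ψ.2.2⟩
      map_add' := fun x y => Subtype.ext (A.map_add ⟨x.1, x.2.1⟩ ⟨y.1, y.2.1⟩)
      map_smul' := fun c x => Subtype.ext (A.map_smul c ⟨x.1, x.2.1⟩) }

/-- `A` and `B` map `D` into their domains and satisfy `[A, B] ψ = 0` for all `ψ ∈ D`. -/
def CommuteOn (A B : H →ₗ.[ℂ] H) (D : Submodule ℂ H) : Prop :=
  ∀ ψ ∈ D, ∃ (hA : ψ ∈ A.domain) (hB : ψ ∈ B.domain)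
    (hAB : B ⟨ψ, hB⟩ ∈ A.domain) (hBA : A ⟨ψ, hA⟩ ∈ B.domain),
    A ⟨B ⟨ψ, hB⟩, hAB⟩ - B ⟨A ⟨ψ, hA⟩, hBA⟩ = 0

/-- `W = exp (i A)`: the unitary `W` is the value at time `1` of a strongly continuous one-parameter
unitary group whose infinitesimal generator (with its exact domain) is `A`. -/
def IsExpI (A : H →ₗ.[ℂ] H) (W : H ≃ₗᵢ[ℂ] H) : Prop :=
  ∃ T : ℝ → (H ≃ₗᵢ[ℂ] H),
    T 0 = 1 ∧ (∀ s t, T (s + t) = T s * T t) ∧ (∀ ψ, Continuous fun t => T t ψ) ∧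
    (∀ ψ φ : H, (ψ, φ) ∈ A.graph ↔
      Tendsto (fun t : ℝ => ((t : ℂ)⁻¹) • (T t ψ - ψ)) (𝓝[≠] 0) (𝓝 (Complex.I • φ))) ∧
    T 1 = W

/-- The operator `p · X = ∑ μ, p_μ X^μ` with domain `D` (when `D` lies in all the domains). -/
def contraction {d : ℕ} (X : Fin d → (H →ₗ.[ℂ] H)) (D : Submodule ℂ H) (p : Fin d → ℝ) :
    H →ₗ.[ℂ] H :=
  ∑ μ, (p μ : ℂ) • (X μ).domRestrict D

/-- The components `X μ` are essentially self-adjoint on the dense domain `D`, which they leave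
invariant, and they commute there. -/
structure IsCommutingEssSelfAdjoint [CompleteSpace H] {d : ℕ} (X : Fin d → (H →ₗ.[ℂ] H))
    (D : Submodule ℂ H) : Prop where
  dense : Dense (D : Set H)
  le_domain : ∀ μ, D ≤ (X μ).domain
  essSelfAdjoint : ∀ μ, IsEssentiallySelfAdjoint ((X μ).domRestrict D)
  mapsTo : ∀ μ (ψ : (X μ).domain), (ψ : H) ∈ D → X μ ψ ∈ D
  commute : ∀ μ ν, CommuteOn (X μ) (X ν) D

/-- Every `p · X` is essentially self-adjoint on `D`, so that its closure has a well-defined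
exponential `U p = exp (i p · X)`, and `U` is a strongly continuous unitary representation of the
additive group `ℝ^d`. -/
def GeneratesUnitaryGroup [CompleteSpace H] {d : ℕ} (X : Fin d → (H →ₗ.[ℂ] H))
    (D : Submodule ℂ H) : Prop :=
  (∀ p : Fin d → ℝ, IsEssentiallySelfAdjoint (contraction X D p)) ∧
  ∃ U : (Fin d → ℝ) → (H ≃ₗᵢ[ℂ] H),
    (∀ p, IsExpI (contraction X D p).closure (U p) ∧
      ∀ W, IsExpI (contraction X D p).closure W → W = U p) ∧
    U 0 = 1 ∧ (∀ p q, U (p + q) = U p * U q) ∧ ∀ ψ, Continuous fun p => U p ψ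

end Operators

/-! ### Hilbert direct sums -/

section DirectSum

variable {E : ℕ → Type*} [∀ k, NormedAddCommGroup (E k)] [∀ k, InnerProductSpace ℂ (E k)]

lemma memlp_map (W : ∀ k, E k ≃ₗᵢ[ℂ] E k) (ψ : lp E 2) : Memℓp (fun k => W k (ψ k)) 2 := by
  have h := lp.memℓp ψ
  rw [memℓp_gen_iff (by norm_num)] at h ⊢
  simpa using h

/-- The direct sum `⨁ k, W k` of unitary operators. -/
def directSumUnitary (W : ∀ k, E k ≃ₗᵢ[ℂ] E k) : lp E 2 ≃ₗᵢ[ℂ] lp E 2 where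
  toFun := fun ψ => ⟨fun k => W k (ψ k), memlp_map W ψ⟩
  invFun := fun ψ => ⟨fun k => (W k).symm (ψ k), memlp_map (fun k => (W k).symm) ψ⟩
  left_inv := fun ψ => by ext k; simp
  right_inv := fun ψ => by ext k; simp
  map_add' := fun x y => by ext k; exact map_add (W k) (x k) (y k)
  map_smul' := fun c x => by ext k; simp
  norm_map' := fun ψ => by
    simp [lp.norm_eq_tsum_rpow (p := 2) (by norm_num)]

/-- The direct sum `⨁ k, A k` of operators, on its maximal domain. -/
def directSumOp (A : ∀ k, E k →ₗ.[ℂ] E k) : lp E 2 →ₗ.[ℂ] lp E 2 where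
  domain :=
    { carrier := {ψ | ∃ h : ∀ k, ψ k ∈ (A k).domain, Memℓp (fun k => A k ⟨ψ k, h k⟩) 2}
      zero_mem' := ⟨fun k => (A k).domain.zero_mem, by
        have : (fun k => A k ⟨(0 : lp E 2) k, (A k).domain.zero_mem⟩) = 0 := by
          ext k; exact (A k).map_zero
        rw [this]; exact zero_memℓp⟩
      add_mem' := by
        rintro x y ⟨hx, hx'⟩ ⟨hy, hy'⟩
        refine ⟨fun k => (A k).domain.add_mem (hx k) (hy k), ?_⟩
        have : (fun k => A k ⟨(x + y) k, (A k).domain.add_mem (hx k) (hy k)⟩) =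
            (fun k => A k ⟨x k, hx k⟩) + fun k => A k ⟨y k, hy k⟩ := by
          ext k; exact (A k).map_add ⟨x k, hx k⟩ ⟨y k, hy k⟩
        rw [this]; exact hx'.add hy'
      smul_mem' := by
        rintro c x ⟨hx, hx'⟩
        refine ⟨fun k => (A k).domain.smul_mem c (hx k), ?_⟩
        have : (fun k => A k ⟨(c • x) k, (A k).domain.smul_mem c (hx k)⟩) =
            c • fun k => A k ⟨x k, hx k⟩ := by
          ext k; exact (A k).map_smul c ⟨x k, hx k⟩
        rw [this]; exact hx'.const_smul c }
  toFun :=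
    { toFun := fun ψ => ⟨fun k => A k ⟨ψ.1 k, ψ.2.1 k⟩, ψ.2.2⟩
      map_add' := fun x y => by
        ext k; exact (A k).map_add ⟨x.1 k, x.2.1 k⟩ ⟨y.1 k, y.2.1 k⟩
      map_smul' := fun c x => by
        ext k; exact (A k).map_smul c ⟨x.1 k, x.2.1 k⟩ }

/-- Vectors with finitely many nonzero components, the `k`-th one in `D k`. -/
def finiteSum (D : ∀ k, Submodule ℂ (E k)) : Submodule ℂ (lp E 2) where
  carrier := {ψ | (∀ k, ψ k ∈ D k) ∧ {k | ψ k ≠ 0}.Finite}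
  zero_mem' := ⟨fun k => (D k).zero_mem, by simp⟩
  add_mem' := by
    rintro x y ⟨hx, hx'⟩ ⟨hy, hy'⟩
    refine ⟨fun k => (D k).add_mem (hx k) (hy k), (hx'.union hy').subset ?_⟩
    intro k hk
    by_contra h
    simp only [Set.mem_union, Set.mem_ofPred_eq, not_or, not_not] at h
    exact hk (by simp [h.1, h.2])
  smul_mem' := by
    rintro c x ⟨hx, hx'⟩
    refine ⟨fun k => (D k).smul_mem c (hx k), hx'.subset ?_⟩
    intro k hk h
    exact hk (by simp [h])

/-- Vectors whose `k`-th component lies in `K k` for every `k`. -/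
def componentwise (K : ∀ k, Submodule ℂ (E k)) : Submodule ℂ (lp E 2) :=
  ⨅ k, (K k).comap (lp.evalₗ E 2 k (𝕜 := ℂ))

instance (K : ∀ k, Submodule ℂ (E k)) [∀ k, CompleteSpace (E k)] [∀ k, CompleteSpace (K k)] :
    CompleteSpace (componentwise K) := by
  have : IsClosed (componentwise K : Set (lp E 2)) := by
    have h : (componentwise K : Set (lp E 2)) =
        ⋂ k, (fun ψ => lp.evalCLM ℂ E 2 k ψ) ⁻¹' (K k : Set (E k)) := by
      ext ψ; simp [componentwise]; rfl
    rw [h]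
    refine isClosed_iInter fun k => IsClosed.preimage (lp.evalCLM ℂ E 2 k).continuous ?_
    exact (completeSpace_coe_iff_isComplete.1 inferInstance).isClosed
  exact this.completeSpace_coe

end DirectSum

/-! ### Tensor powers of `L²` -/

section Tensor

variable {α : Type*} [MeasurableSpace α]

/-- Multiplication by the real function `a` on its maximal domain in `L²(ν)`. -/
def mulOp (ν : Measure α) (a : α → ℝ) : Lp ℂ 2 ν →ₗ.[ℂ] Lp ℂ 2 ν where
  domain :=
    { carrier := {f | MemLp (fun x => (a x : ℂ) * f x) 2 ν}
      zero_mem' := by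
        refine (MemLp.zero (ε := ℂ)).ae_eq ?_
        filter_upwards [Lp.coeFn_zero ℂ 2 ν] with x hx
        rw [hx]; simp
      add_mem' := by
        intro f g hf hg
        refine (MemLp.add hf hg).ae_eq ?_
        filter_upwards [Lp.coeFn_add f g] with x hx
        rw [hx]; simp only [Pi.add_apply]; ring
      smul_mem' := by
        intro c f hf
        refine (MemLp.const_smul hf c).ae_eq ?_
        filter_upwards [Lp.coeFn_smul c f] with x hx
        simp [hx, mul_left_comm] }
  toFun :=
    { toFun := fun f => MemLp.toLp _ f.2
      map_add' := by
        intro f g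
        rw [← MemLp.toLp_add]
        refine MemLp.toLp_congr _ _ ?_
        filter_upwards [Lp.coeFn_add f.1 g.1] with x hx
        simp only [Submodule.coe_add, Pi.add_apply]; rw [hx, Pi.add_apply]; ring
      map_smul' := by
        intro c f
        rw [RingHom.id_apply, ← MemLp.toLp_const_smul]
        refine MemLp.toLp_congr _ _ ?_
        filter_upwards [Lp.coeFn_smul c f.1] with x hx
        simp [hx, mul_left_comm] }

variable (ν : Measure α) [SigmaFinite ν]

/-- The `k`-fold Hilbert space tensor power of `L²(α, ν)`, realized as `L²(α^k, ν^k)`. -/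
abbrev TensorPow (k : ℕ) : Type _ := Lp ℂ 2 (Measure.pi fun _ : Fin k => ν)

variable {ν} {k : ℕ}

lemma memLp_prod (f : Fin k → Lp ℂ 2 ν) :
    MemLp (fun x : Fin k → α => ∏ i, f i (x i)) 2 (Measure.pi fun _ : Fin k => ν) := by
  rw [memLp_two_iff_integrable_sq_norm]
  · have h := Integrable.fintype_prod (μ := fun _ : Fin k => ν)
      (f := fun i x => ‖f i x‖ ^ 2) (fun i => (Lp.memLp (f i)).integrable_norm_pow (by norm_num))
    simpa [Finset.prod_pow] using h
  · refine Finset.aestronglyMeasurable_fun_prod _ fun i _ => ?_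
    exact (Lp.aestronglyMeasurable (f i)).comp_quasiMeasurePreserving
      (Measure.quasiMeasurePreserving_eval _ i)

/-- The elementary tensor `f₁ ⊗ ⋯ ⊗ f_k`, that is `(x₁, …, x_k) ↦ f₁ x₁ ⋯ f_k x_k`. -/
def tensor (f : Fin k → Lp ℂ 2 ν) : TensorPow ν k := (memLp_prod f).toLp _

/-- On elementary tensors, multiplication by `a x₁ + ⋯ + a x_k` is the second quantization
`∑ j, 1 ⊗ ⋯ ⊗ a ⊗ ⋯ ⊗ 1` of multiplication by `a`. -/
lemma mulOp_sum_tensor (a : α → ℝ) (f : Fin k → (mulOp ν a).domain) :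
    (tensor fun i => (f i : Lp ℂ 2 ν),
      ∑ j, tensor (Function.update (fun i => (f i : Lp ℂ 2 ν)) j (mulOp ν a (f j)))) ∈
      (mulOp (Measure.pi fun _ : Fin k => ν) fun x => ∑ j, a (x j)).graph := by
  set g : Fin k → Lp ℂ 2 ν := fun i => (f i : Lp ℂ 2 ν) with hg
  have h1 : ∀ᵐ x ∂(Measure.pi fun _ : Fin k => ν), ∀ j,
      (mulOp ν a (f j) : Lp ℂ 2 ν) (x j) = a (x j) * g j (x j) :=
    ae_all_iff.2 fun j => (Measure.quasiMeasurePreserving_eval (fun _ : Fin k => ν) j).ae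
      (MemLp.coeFn_toLp (f j).2)
  have h2 : ∀ᵐ x ∂(Measure.pi fun _ : Fin k => ν), ∀ j,
      tensor (Function.update g j (mulOp ν a (f j))) x =
        ∏ i, Function.update g j (mulOp ν a (f j)) i (x i) :=
    ae_all_iff.2 fun j => MemLp.coeFn_toLp (memLp_prod _)
  have key : ((∑ j, tensor (Function.update g j (mulOp ν a (f j))) : TensorPow ν k) :
      (Fin k → α) → ℂ) =ᵐ[Measure.pi fun _ : Fin k => ν]
      fun x => ((∑ j, a (x j) : ℝ) : ℂ) * tensor g x := by
    filter_upwards [h1, h2, MemLp.coeFn_toLp (memLp_prod g),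
      Lp.coeFn_finsetSum (s := Finset.univ)
        fun j => tensor (Function.update g j (mulOp ν a (f j)))] with x h1 h2 h3 h4
    rw [h4, Finset.sum_apply, tensor, h3, Complex.ofReal_sum, Finset.sum_mul]
    refine Finset.sum_congr rfl fun j _ => ?_
    rw [h2, ← Finset.mul_prod_erase _ _ (Finset.mem_univ j),
      ← Finset.mul_prod_erase Finset.univ (fun i => g i (x i)) (Finset.mem_univ j),
      Function.update_self, h1, mul_assoc]
    congr 2
    refine Finset.prod_congr rfl fun i hi => ?_
    rw [Function.update_of_ne (Finset.ne_of_mem_erase hi)]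
  have hmem := (Lp.memLp (∑ j, tensor (Function.update g j (mulOp ν a (f j))))).ae_eq key
  refine (LinearPMap.mem_graph_iff _).2 ⟨⟨tensor g, hmem⟩, rfl, ?_⟩
  refine Lp.ext ((MemLp.coeFn_toLp hmem).trans key.symm)

lemma inner_tensor (f g : Fin k → Lp ℂ 2 ν) :
    ⟪tensor f, tensor g⟫_ℂ = ∏ i, ⟪f i, g i⟫_ℂ := by
  rw [L2.inner_def]
  simp_rw [L2.inner_def]
  rw [← integral_fintype_prod_eq_prod (𝕜 := ℂ) (μ := fun _ : Fin k => ν)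
    (f := fun i x => ⟪f i x, g i x⟫_ℂ)]
  refine integral_congr_ae ?_
  filter_upwards [MemLp.coeFn_toLp (memLp_prod f), MemLp.coeFn_toLp (memLp_prod g)] with x hf hg
  rw [tensor, tensor, hf, hg]
  simp [RCLike.inner_apply, Finset.prod_mul_distrib]

lemma setIntegral_box_eq_zero {h : TensorPow ν k} (hh : ∀ f, ⟪tensor f, h⟫_ℂ = 0)
    (s : Fin k → Set α) (hs : ∀ i, MeasurableSet (s i)) (hν : ∀ i, ν (s i) ≠ ∞) :
    ∫ x in Set.univ.pi s, h x ∂(Measure.pi fun _ : Fin k => ν) = 0 := by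
  have hpi : MeasurableSet (Set.univ.pi s) := MeasurableSet.univ_pi hs
  have hfin : (Measure.pi fun _ : Fin k => ν) (Set.univ.pi s) ≠ ∞ := by
    rw [Measure.pi_pi]
    exact ENNReal.prod_ne_top fun i _ => hν i
  rw [← L2.inner_indicatorConstLp_one hpi hfin h, ← hh fun i => indicatorConstLp 2 (hs i) (hν i) 1]
  congr 1
  refine Lp.ext ?_
  have h1 : ∀ᵐ x ∂(Measure.pi fun _ : Fin k => ν), ∀ i,
      indicatorConstLp 2 (hs i) (hν i) (1 : ℂ) (x i) = (s i).indicator (fun _ => 1) (x i) :=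
    ae_all_iff.2 fun i => (Measure.quasiMeasurePreserving_eval (fun _ : Fin k => ν) i).ae
      (indicatorConstLp_coeFn (p := 2) (hs := hs i) (hμs := hν i) (c := (1 : ℂ)))
  filter_upwards [indicatorConstLp_coeFn (p := 2) (hs := hpi) (hμs := hfin) (c := (1 : ℂ)),
    MemLp.coeFn_toLp (memLp_prod fun i => indicatorConstLp 2 (hs i) (hν i) (1 : ℂ)), h1]
    with x hx hx' hx1
  rw [hx, tensor, hx']
  simp_rw [hx1]
  by_cases hxs : x ∈ Set.univ.pi s
  · rw [Set.indicator_of_mem hxs]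
    refine (Finset.prod_eq_one fun i _ => ?_).symm
    rw [Set.indicator_of_mem (hxs i (Set.mem_univ i))]
  · rw [Set.indicator_of_notMem hxs]
    simp only [Set.mem_pi, Set.mem_univ, true_implies, not_forall] at hxs
    obtain ⟨i, hi⟩ := hxs
    refine (Finset.prod_eq_zero (Finset.mem_univ i) ?_).symm
    rw [Set.indicator_of_notMem hi]

lemma eq_zero_of_inner_tensor {h : TensorPow ν k} (hh : ∀ f, ⟪tensor f, h⟫_ℂ = 0) : h = 0 := by
  set π : Measure (Fin k → α) := Measure.pi fun _ : Fin k => ν with hπ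
  have key : ∀ N : ℕ, ∀ t, MeasurableSet t →
      ∫ x in t ∩ Set.univ.pi (fun _ : Fin k => spanningSets ν N), h x ∂π = 0 := by
    intro N
    set B : Set (Fin k → α) := Set.univ.pi fun _ : Fin k => spanningSets ν N with hB
    have hBm : MeasurableSet B := MeasurableSet.univ_pi fun _ => measurableSet_spanningSets ν N
    have hBf : π B ≠ ∞ := by
      rw [hπ, hB, Measure.pi_pi]
      exact ENNReal.prod_ne_top fun i _ => (measure_spanningSets_lt_top ν N).ne
    have hint : IntegrableOn h B π := by
      have : Fact (π B < ∞) := ⟨hBf.lt_top⟩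
      exact (((Lp.memLp h).restrict B).mono_exponent (by norm_num)).integrable le_rfl
    have hB0 : ∫ x in B, h x ∂π = 0 :=
      setIntegral_box_eq_zero hh _ (fun _ => measurableSet_spanningSets ν N)
        fun _ => (measure_spanningSets_lt_top ν N).ne
    intro t ht
    induction t, ht using MeasurableSpace.induction_on_inter
      (generateFrom_pi (α := fun _ : Fin k => α)).symm isPiSystem_pi with
    | empty => simp
    | basic t ht =>
      obtain ⟨s, hs, rfl⟩ := ht
      rw [hB, ← Set.pi_inter_distrib]
      refine setIntegral_box_eq_zero hh _
        (fun i => (hs i (Set.mem_univ i)).inter (measurableSet_spanningSets ν N)) fun i => ?_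
      exact ((measure_mono Set.inter_subset_right).trans_lt (measure_spanningSets_lt_top ν N)).ne
    | compl t ht ih =>
      have h1 := setIntegral_union (μ := π) (f := h) (s := t ∩ B) (t := tᶜ ∩ B)
        (Set.disjoint_left.2 fun x hx hx' => hx'.1 hx.1) (ht.compl.inter hBm)
        (hint.mono_set Set.inter_subset_right) (hint.mono_set Set.inter_subset_right)
      rw [← Set.union_inter_distrib_right, Set.union_compl_self, Set.univ_inter, hB0, ih,
        zero_add] at h1
      exact h1.symm
    | iUnion t hd ht ih =>
      rw [Set.iUnion_inter, integral_iUnion (fun i => (ht i).inter hBm)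
        (fun i j hij => (hd hij).mono Set.inter_subset_left Set.inter_subset_left)
        (hint.mono_set (Set.iUnion_subset fun i => Set.inter_subset_right))]
      simp [ih]
  have hae : ∀ N : ℕ, ∀ᵐ x ∂π,
      x ∈ Set.univ.pi (fun _ : Fin k => spanningSets ν N) → h x = 0 := by
    intro N
    set B : Set (Fin k → α) := Set.univ.pi fun _ : Fin k => spanningSets ν N with hB
    have hBm : MeasurableSet B := MeasurableSet.univ_pi fun _ => measurableSet_spanningSets ν N
    have hBf : π B ≠ ∞ := by
      rw [hπ, hB, Measure.pi_pi]
      exact ENNReal.prod_ne_top fun i _ => (measure_spanningSets_lt_top ν N).ne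
    have hint : IntegrableOn h B π := by
      have : Fact (π B < ∞) := ⟨hBf.lt_top⟩
      exact (((Lp.memLp h).restrict B).mono_exponent (by norm_num)).integrable le_rfl
    refine (ae_restrict_iff' hBm).1 ?_
    refine Integrable.ae_eq_zero_of_forall_setIntegral_eq_zero hint fun t ht _ => ?_
    rw [Measure.restrict_restrict ht]
    exact key N t ht
  refine Lp.ext ?_
  filter_upwards [ae_all_iff.2 hae, Lp.coeFn_zero ℂ 2 π] with x hx hx0
  rw [hx0]
  have hmem : ∀ i : Fin k, ∃ N, x i ∈ spanningSets ν N := fun i =>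
    ⟨_, mem_spanningSetsIndex ν (x i)⟩
  choose N hN using hmem
  refine hx (Finset.univ.sup N) fun i _ => ?_
  exact monotone_spanningSets ν (Finset.le_sup (Finset.mem_univ i)) (hN i)

lemma norm_linearCombination_eq {ι E : Type*} [NormedAddCommGroup E] [InnerProductSpace ℂ E]
    {u v : ι → E} (h : ∀ i j, ⟪u i, u j⟫_ℂ = ⟪v i, v j⟫_ℂ) (c : ι →₀ ℂ) :
    ‖Finsupp.linearCombination ℂ u c‖ = ‖Finsupp.linearCombination ℂ v c‖ := by
  have : ⟪Finsupp.linearCombination ℂ u c, Finsupp.linearCombination ℂ u c⟫_ℂ =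
      ⟪Finsupp.linearCombination ℂ v c, Finsupp.linearCombination ℂ v c⟫_ℂ := by
    simp only [Finsupp.linearCombination_apply, Finsupp.sum_inner, Finsupp.inner_sum, inner_smul_left,
      inner_smul_right, h]
  rw [@norm_eq_sqrt_re_inner ℂ, @norm_eq_sqrt_re_inner ℂ, this]

lemma denseRange_tensor :
    DenseRange (Finsupp.linearCombination ℂ (tensor : (Fin k → Lp ℂ 2 ν) → TensorPow ν k)) := by
  have h : (LinearMap.range (Finsupp.linearCombination ℂ
      (tensor : (Fin k → Lp ℂ 2 ν) → TensorPow ν k))).topologicalClosure = ⊤ := by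
    rw [Submodule.topologicalClosure_eq_top_iff, Submodule.eq_bot_iff]
    intro x hx
    refine eq_zero_of_inner_tensor fun f => ?_
    refine (Submodule.mem_orthogonal _ _).1 hx _ ⟨Finsupp.single f 1, by simp⟩
  exact Submodule.dense_iff_topologicalClosure_eq_top.2 h

/-- `V^{⊗k}` as a bounded operator: the continuous linear extension of
`f₁ ⊗ ⋯ ⊗ f_k ↦ V f₁ ⊗ ⋯ ⊗ V f_k`. -/
def tensorPowCLM (V : Lp ℂ 2 ν ≃ₗᵢ[ℂ] Lp ℂ 2 ν) (k : ℕ) : TensorPow ν k →L[ℂ] TensorPow ν k :=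
  (Finsupp.linearCombination ℂ fun f : Fin k → Lp ℂ 2 ν => tensor fun i => V (f i)).extendOfNorm
    (Finsupp.linearCombination ℂ tensor)

lemma tensorPowCLM_linearCombination (V : Lp ℂ 2 ν ≃ₗᵢ[ℂ] Lp ℂ 2 ν)
    (c : (Fin k → Lp ℂ 2 ν) →₀ ℂ) :
    tensorPowCLM V k (Finsupp.linearCombination ℂ tensor c) =
      Finsupp.linearCombination ℂ (fun f : Fin k → Lp ℂ 2 ν => tensor fun i => V (f i)) c := by
  refine LinearMap.extendOfNorm_eq denseRange_tensor ⟨1, fun x => ?_⟩ c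
  rw [one_mul]
  exact (norm_linearCombination_eq (fun f g => by simp [inner_tensor]) x).le

lemma tensorPowCLM_tensor (V : Lp ℂ 2 ν ≃ₗᵢ[ℂ] Lp ℂ 2 ν) (f : Fin k → Lp ℂ 2 ν) :
    tensorPowCLM V k (tensor f) = tensor fun i => V (f i) := by
  simpa using tensorPowCLM_linearCombination V (Finsupp.single f 1)

lemma tensorPowCLM_comp (V W : Lp ℂ 2 ν ≃ₗᵢ[ℂ] Lp ℂ 2 ν) (h : ∀ f, V (W f) = f)
    (ψ : TensorPow ν k) : tensorPowCLM V k (tensorPowCLM W k ψ) = ψ := by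
  refine denseRange_tensor.induction_on ψ (isClosed_eq (by fun_prop) continuous_id) fun c => ?_
  induction c using Finsupp.induction_linear with
  | zero => simp
  | add c d hc hd => rw [map_add, map_add, map_add, hc, hd]
  | single f a => simp [tensorPowCLM_tensor, h]

lemma norm_tensorPowCLM (V : Lp ℂ 2 ν ≃ₗᵢ[ℂ] Lp ℂ 2 ν) (ψ : TensorPow ν k) :
    ‖tensorPowCLM V k ψ‖ = ‖ψ‖ := by
  refine denseRange_tensor.induction_on ψ (isClosed_eq (by fun_prop) continuous_norm) fun c => ?_
  rw [tensorPowCLM_linearCombination]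
  exact norm_linearCombination_eq (fun f g => by simp [inner_tensor]) c

/-- The tensor power `V^{⊗k}` of a unitary operator `V`. -/
def tensorPow (V : Lp ℂ 2 ν ≃ₗᵢ[ℂ] Lp ℂ 2 ν) (k : ℕ) : TensorPow ν k ≃ₗᵢ[ℂ] TensorPow ν k where
  toFun := tensorPowCLM V k
  invFun := tensorPowCLM V.symm k
  left_inv := tensorPowCLM_comp _ _ fun f => V.symm_apply_apply f
  right_inv := tensorPowCLM_comp _ _ fun f => V.apply_symm_apply f
  map_add' := map_add _
  map_smul' := map_smul _
  norm_map' := norm_tensorPowCLM V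

lemma tensorPow_tensor (V : Lp ℂ 2 ν ≃ₗᵢ[ℂ] Lp ℂ 2 ν) (f : Fin k → Lp ℂ 2 ν) :
    tensorPow V k (tensor f) = tensor fun i => V (f i) := tensorPowCLM_tensor V f

lemma measurePreserving_perm (σ : Equiv.Perm (Fin k)) :
    MeasurePreserving (fun x : Fin k → α => x ∘ σ) (Measure.pi fun _ => ν)
      (Measure.pi fun _ => ν) :=
  by
  convert! measurePreserving_piCongrLeft (fun _ : Fin k => ν) σ.symm using 1
  ext x i
  have := MeasurableEquiv.piCongrLeft_apply_apply (β := fun _ : Fin k => α) σ.symm x (σ i)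
  simpa using this.symm

variable (ν k) in
/-- The bosonic (totally symmetric) `k`-particle subspace. -/
def symmetricSubspace : Submodule ℂ (TensorPow ν k) :=
  ⨅ σ : Equiv.Perm (Fin k), LinearMap.ker
    ((Lp.compMeasurePreservingₗᵢ ℂ (E := ℂ) (p := 2) _
      (measurePreserving_perm (ν := ν) σ)).toLinearMap - LinearMap.id)

instance : CompleteSpace (symmetricSubspace ν k) := by
  have : IsClosed (symmetricSubspace ν k : Set (TensorPow ν k)) := by
    rw [symmetricSubspace, Submodule.coe_iInf]
    refine isClosed_iInter fun σ => ?_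
    exact ((Lp.compMeasurePreservingₗᵢ ℂ (E := ℂ) (p := 2) _
      (measurePreserving_perm (ν := ν) σ)).toContinuousLinearMap -
        ContinuousLinearMap.id ℂ _).isClosed_ker
  exact this.completeSpace_coe

end Tensor

/-! ### The free scalar field -/

/-- The relativistic energy `ω_p = √(|p|² + m²)`. -/
def energy {n : ℕ} (m : ℝ) (p : EuclideanSpace ℝ (Fin n)) : ℝ := √(‖p‖ ^ 2 + m ^ 2)

/-- The point `(ω_p, p)` of the mass shell `H_m^+ ⊆ ℝ^{n+1}`. -/
def fourMomentum {n : ℕ} (m : ℝ) (p : EuclideanSpace ℝ (Fin n)) : Fin (n + 1) → ℝ :=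
  Fin.cons (energy m p) fun j => p j

/-- The invariant measure `d^n p / (2 ω_p)`. -/
def shellMeasure (n : ℕ) (m : ℝ) : Measure (EuclideanSpace ℝ (Fin n)) :=
  volume.withDensity fun p => ENNReal.ofReal ((2 * energy m p)⁻¹)

instance (n : ℕ) (m : ℝ) : SigmaFinite (shellMeasure n m) :=
  SigmaFinite.withDensity_ofReal _

/-- The one-particle Hilbert space. -/
abbrev OneParticle (n : ℕ) (m : ℝ) : Type := Lp ℂ 2 (shellMeasure n m)

/-- The `k`-particle space `ℋ₁^{⊗k}`, before symmetrization. -/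
abbrev KParticle (n : ℕ) (m : ℝ) (k : ℕ) : Type := TensorPow (shellMeasure n m) k

/-- The (full) Fock space `⨁ k, ℋ₁^{⊗k}`. -/
abbrev Fock (n : ℕ) (m : ℝ) : Type := lp (fun k => KParticle n m k) 2

/-- The bosonic Fock space, a closed subspace of the full one. -/
abbrev bosonicFock (n : ℕ) (m : ℝ) : Submodule ℂ (Fock n m) :=
  componentwise fun k => symmetricSubspace (shellMeasure n m) k

/-- The momentum operator `P^μ` on the `k`-particle space: multiplication by the total momentum
`p₁^μ + ⋯ + p_k^μ`, that is `∑ j, 1 ⊗ ⋯ ⊗ P^μ ⊗ ⋯ ⊗ 1`. -/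
def momentumK (n : ℕ) (m : ℝ) (k : ℕ) (μ : Fin (n + 1)) : KParticle n m k →ₗ.[ℂ] KParticle n m k :=
  mulOp _ fun x => ∑ j, fourMomentum m (x j) μ

/-- The second quantized momentum operator `P^μ` on Fock space, on its maximal domain (the operator
with lower index is `P_μ = ± P^μ`). -/
def momentum (n : ℕ) (m : ℝ) (μ : Fin (n + 1)) : Fock n m →ₗ.[ℂ] Fock n m :=
  directSumOp fun k => momentumK n m k μ

/-- The second quantization `Γ(V) = ⨁ k, V^{⊗k}`. -/
def Gam {n : ℕ} {m : ℝ} (V : OneParticle n m ≃ₗᵢ[ℂ] OneParticle n m) : Fock n m ≃ₗᵢ[ℂ] Fock n m :=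
  directSumUnitary fun k => tensorPow V k

/-- `Δ(P)`: the `f ∈ ℋ₁` such that `|p|^{2r} |f(p)|` is (essentially) bounded for all `r ∈ ℕ`. -/
def deltaP (n : ℕ) (m : ℝ) : Submodule ℂ (OneParticle n m) where
  carrier := {f | ∀ r : ℕ, ∃ c : ℝ, ∀ᵐ p ∂(shellMeasure n m), ‖(((‖p‖ ^ 2) ^ r : ℝ) : ℂ) * f p‖ ≤ c}
  zero_mem' := fun r => ⟨0, by
    filter_upwards [Lp.coeFn_zero ℂ 2 (shellMeasure n m)] with p hp
    rw [hp]; simp⟩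
  add_mem' := by
    intro f g hf hg r
    obtain ⟨c, hc⟩ := hf r
    obtain ⟨d, hd⟩ := hg r
    refine ⟨c + d, ?_⟩
    filter_upwards [hc, hd, Lp.coeFn_add f g] with p h1 h2 h3
    rw [h3, Pi.add_apply, mul_add]
    exact (norm_add_le _ _).trans (add_le_add h1 h2)
  smul_mem' := by
    intro a f hf r
    obtain ⟨c, hc⟩ := hf r
    refine ⟨‖a‖ * c, ?_⟩
    filter_upwards [hc, Lp.coeFn_smul a f] with p h1 h2
    rw [h2, Pi.smul_apply, smul_eq_mul, mul_left_comm, norm_mul]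
    exact mul_le_mul_of_nonneg_left h1 (norm_nonneg a)

/-- `Δ_k(P)`, the algebraic `k`-fold tensor power of `Δ(P)`. -/
def deltaKP (n : ℕ) (m : ℝ) (k : ℕ) : Submodule ℂ (KParticle n m k) :=
  Submodule.span ℂ {ψ | ∃ f : Fin k → OneParticle n m, (∀ i, f i ∈ deltaP n m) ∧ ψ = tensor f}

/-- The domain on Fock space given by all the `Δ_k(P)`: finite sums of vectors in them. -/
def deltaFockP (n : ℕ) (m : ℝ) : Submodule ℂ (Fock n m) := finiteSum fun k => deltaKP n m k

section X

variable {n : ℕ} {m : ℝ} (V : OneParticle n m ≃ₗᵢ[ℂ] OneParticle n m)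

/-- The operator `X^μ = Γ(V⁻¹) P^μ Γ(V)` on Fock space. -/
def opX (μ : Fin (n + 1)) : Fock n m →ₗ.[ℂ] Fock n m :=
  sandwich (Gam V.symm) (momentum n m μ) (Gam V)

/-- The domain `Γ(V⁻¹) ⨁ k, Δ_k(P)` on Fock space. -/
def deltaFockX : Submodule ℂ (Fock n m) :=
  (deltaFockP n m).map (Gam V.symm).toLinearEquiv.toLinearMap

/-- The restriction of `X^μ` to the `k`-particle space. -/
def opXK (k : ℕ) (μ : Fin (n + 1)) : KParticle n m k →ₗ.[ℂ] KParticle n m k :=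
  sandwich (tensorPow V.symm k) (momentumK n m k μ) (tensorPow V k)

/-- The domain `Δ_k(X) = Γ(V⁻¹) Δ_k(P)` in the `k`-particle space. -/
def deltaKX (k : ℕ) : Submodule ℂ (KParticle n m k) :=
  (deltaKP n m k).map (tensorPow V.symm k).toLinearEquiv.toLinearMap

end X

end WarpedQFT

end

open WarpedQFT

/-!
In the momentum representation the `P^μ` are multiplication operators, and the phases
`exp (i p · P)` form a strongly continuous unitary representation of `ℝ^d` which leaves the domains
`Δ_k(P)` invariant and is differentiable on them by dominated convergence.

A symmetric operator `A` that generates a unitary group `T` on a dense `T`-invariant domain is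
essentially self-adjoint there: if `φ` lies in the domain of `A*`, then `⟪ψ, T t φ⟫` is
differentiable for every `ψ` in the domain of `A`, with derivative `⟪ψ, i T t A* φ⟫`, so `T t φ` is
the integral of its weak derivative and hence differentiable. Thus `A*` is the full generator of
`T`, on which `T`-invariance again holds, so `A* = A**`, and this is the closure of `A`. Commutation
of the components follows by differentiating the commutation of the groups.

All this applies to every domain on which a unitary representation integrates the operators, a
property stable under unitary conjugation, direct sums and restriction to invariant closed
subspaces. Only density on the bosonic subspaces needs an argument: symmetrization is a continuous
projection that maps `Δ_k(X)` into itself.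
-/

noncomputable section

namespace WarpedQFT

/-! ### Unitary representations and their generators -/

section UnitaryRep

variable {H H' : Type*} [NormedAddCommGroup H] [InnerProductSpace ℂ H] [NormedAddCommGroup H']
  [InnerProductSpace ℂ H']

/-- `U` is a strongly continuous unitary representation of the additive monoid `G`. It is kept as a
predicate on functions, and not bundled, because the target notions are stated for functions. -/
structure IsUnitaryRep {G : Type*} [AddMonoid G] [TopologicalSpace G] (U : G → H ≃ₗᵢ[ℂ] H) :
    Prop where
  map_zero : U 0 = 1
  map_add : ∀ g h, U (g + h) = U g * U h
  continuous : ∀ ψ, Continuous fun g => U g ψ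

/-- `ψ` lies in the domain of the generator of the one-parameter group `T`, and the generator maps
it to `φ`: the derivative of `t ↦ T t ψ` at `0` is `i φ`. -/
def GeneratesAt (T : ℝ → H ≃ₗᵢ[ℂ] H) (ψ φ : H) : Prop :=
  Tendsto (fun t : ℝ => ((t : ℂ)⁻¹) • (T t ψ - ψ)) (𝓝[≠] 0) (𝓝 (Complex.I • φ))

lemma GeneratesAt.unique {T : ℝ → H ≃ₗᵢ[ℂ] H} {ψ φ φ' : H} (h : GeneratesAt T ψ φ)
    (h' : GeneratesAt T ψ φ') : φ = φ' :=
  smul_right_injective _ Complex.I_ne_zero (tendsto_nhds_unique h h')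

lemma generatesAt_zero (T : ℝ → H ≃ₗᵢ[ℂ] H) : GeneratesAt T 0 0 := by
  simp [GeneratesAt]

lemma GeneratesAt.add {T : ℝ → H ≃ₗᵢ[ℂ] H} {ψ φ ψ' φ' : H} (h : GeneratesAt T ψ φ)
    (h' : GeneratesAt T ψ' φ') : GeneratesAt T (ψ + ψ') (φ + φ') := by
  have hlim := Tendsto.add h h'
  rw [← smul_add] at hlim
  refine hlim.congr fun t => ?_
  rw [map_add, ← smul_add, add_sub_add_comm]

lemma GeneratesAt.map {T : ℝ → H ≃ₗᵢ[ℂ] H} {S : ℝ → H' ≃ₗᵢ[ℂ] H'} {ψ φ : H}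
    (h : GeneratesAt T ψ φ) (L : H →L[ℂ] H') (hL : ∀ t, S t (L ψ) = L (T t ψ)) :
    GeneratesAt S (L ψ) (L φ) := by
  have hlim := (L.continuous.tendsto _).comp h
  rw [map_smul] at hlim
  refine hlim.congr fun t => ?_
  rw [Function.comp_apply, map_smul, map_sub, hL]

namespace IsUnitaryRep

section Group

variable {G : Type*} [AddGroup G] [TopologicalSpace G] {U : G → H ≃ₗᵢ[ℂ] H} (hU : IsUnitaryRep U)
include hU

lemma add_apply (g h : G) (ψ : H) : U (g + h) ψ = U g (U h ψ) := by
  rw [hU.map_add]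
  rfl

lemma inner_apply_left (g : G) (ψ φ : H) : ⟪U g ψ, φ⟫_ℂ = ⟪ψ, U (-g) φ⟫_ℂ := by
  rw [← (U (-g)).inner_map_map, ← hU.add_apply, neg_add_cancel, hU.map_zero,
    LinearIsometryEquiv.coe_one, id_eq]

end Group

lemma commute {G : Type*} [AddCommMonoid G] [TopologicalSpace G] {U : G → H ≃ₗᵢ[ℂ] H}
    (hU : IsUnitaryRep U) (g h : G) : Commute (U g) (U h) := by
  rw [commute_iff_eq, ← hU.map_add, ← hU.map_add, add_comm]

lemma comp_smul {E : Type*} [AddCommGroup E] [Module ℝ E] [TopologicalSpace E]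
    [ContinuousSMul ℝ E] {U : E → H ≃ₗᵢ[ℂ] H} (hU : IsUnitaryRep U) (p : E) :
    IsUnitaryRep fun t : ℝ => U (t • p) where
  map_zero := by rw [zero_smul, hU.map_zero]
  map_add s t := by rw [add_smul, hU.map_add]
  continuous ψ := (hU.continuous ψ).comp (by fun_prop)

variable {T : ℝ → H ≃ₗᵢ[ℂ] H} (hT : IsUnitaryRep T)
include hT

lemma generatesAt_iff_hasDerivAt {ψ φ : H} :
    GeneratesAt T ψ φ ↔ HasDerivAt (fun t => T t ψ) (Complex.I • φ) 0 := by
  rw [hasDerivAt_iff_tendsto_slope_zero]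
  refine tendsto_congr fun t => ?_
  rw [zero_add, hT.map_zero, ← Complex.ofReal_inv, Complex.coe_smul,
    LinearIsometryEquiv.coe_one, id_eq]

lemma generatesAt_apply {ψ φ : H} (h : GeneratesAt T ψ φ) (t : ℝ) :
    GeneratesAt T (T t ψ) (T t φ) :=
  h.map (T t).toContinuousLinearEquiv.toContinuousLinearMap fun s =>
    DFunLike.congr_fun (hT.commute s t) ψ

lemma hasDerivAt {ψ φ : H} (h : GeneratesAt T ψ φ) (t : ℝ) :
    HasDerivAt (fun s => T s ψ) (Complex.I • T t φ) t := by
  have hshift : HasDerivAt (fun s => T s (T t ψ)) (Complex.I • T t φ) (t - t) := by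
    rw [sub_self]
    exact hT.generatesAt_iff_hasDerivAt.1 (hT.generatesAt_apply h t)
  refine (hshift.comp_sub_const t t).congr_of_eventuallyEq (Eventually.of_forall fun s => ?_)
  change T s ψ = T (s - t) (T t ψ)
  rw [← hT.add_apply, sub_add_cancel]

lemma hasDerivAt_neg {ψ φ : H} (h : GeneratesAt T ψ φ) (t : ℝ) :
    HasDerivAt (fun s => T (-s) ψ) (-(Complex.I • T (-t) φ)) t := by
  simpa [Function.comp_def] using (hT.hasDerivAt h (-t)).scomp t (_root_.hasDerivAt_neg t)

lemma inner_left_eq_inner_right {ψ φ χ η : H} (h : GeneratesAt T ψ φ) (h' : GeneratesAt T χ η) :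
    ⟪φ, χ⟫_ℂ = ⟪ψ, η⟫_ℂ := by
  have hleft := (hT.hasDerivAt h 0).inner ℂ (hasDerivAt_const (0 : ℝ) χ)
  have hright := (hasDerivAt_const (0 : ℝ) ψ).inner ℂ (hT.hasDerivAt_neg h' 0)
  simp only [hT.inner_apply_left] at hleft
  have hderiv := hleft.unique hright
  simp only [hT.map_zero, neg_zero, LinearIsometryEquiv.coe_one, id_eq, inner_zero_right,
    inner_zero_left, zero_add, add_zero, inner_smul_left, inner_neg_right, inner_smul_right,
    Complex.conj_I, neg_mul, neg_inj] at hderiv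
  exact mul_left_cancel₀ Complex.I_ne_zero hderiv

lemma eq_of_commute {S : ℝ → H ≃ₗᵢ[ℂ] H} (hS : IsUnitaryRep S)
    (hST : ∀ s t, Commute (S s) (T t)) {D : Set H} (hD : Dense D)
    (hDT : ∀ χ ∈ D, ∃ η, GeneratesAt T χ η) {ψ φ φ' φST φTS : H} (hφ : GeneratesAt S ψ φ)
    (hφ' : GeneratesAt T ψ φ') (hφST : GeneratesAt S φ' φST) (hφTS : GeneratesAt T φ φTS) :
    φST = φTS := by
  refine hD.eq_of_inner_right ℂ fun χ hχ => ?_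
  obtain ⟨η, hη⟩ := hDT χ hχ
  have hsymm : ∀ s, ⟪η, S s ψ⟫_ℂ = ⟪χ, S s φ'⟫_ℂ := fun s =>
    hT.inner_left_eq_inner_right hη <| hφ'.map (S s).toContinuousLinearEquiv.toContinuousLinearMap
      fun t => DFunLike.congr_fun (hST s t).symm ψ
  have hleft := (hasDerivAt_const (0 : ℝ) η).inner ℂ (hS.generatesAt_iff_hasDerivAt.1 hφ)
  have hright := (hasDerivAt_const (0 : ℝ) χ).inner ℂ (hS.generatesAt_iff_hasDerivAt.1 hφST)
  simp only [hsymm] at hleft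
  have hderiv := hleft.unique hright
  simp only [inner_zero_left, add_zero, inner_smul_right] at hderiv
  rw [← mul_left_cancel₀ Complex.I_ne_zero hderiv, hT.inner_left_eq_inner_right hη hφTS]

end IsUnitaryRep

end UnitaryRep

/-! ### Essential self-adjointness on an invariant dense domain -/

section Adjoint

variable {𝕜 E F : Type*} [RCLike 𝕜] [NormedAddCommGroup E] [InnerProductSpace 𝕜 E]
  [CompleteSpace E] [NormedAddCommGroup F] [InnerProductSpace 𝕜 F] [CompleteSpace F]

lemma adjoint_adjoint_le_topologicalClosure (g : Submodule 𝕜 (E × F)) :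
    g.adjoint.adjoint ≤ g.topologicalClosure := by
  -- In the Hilbert space `E × F`, the adjoint of a subspace is its orthogonal complement up to a
  -- rotation by a right angle, so two adjoints amount to two orthogonal complements.
  let e := (WithLp.prodContinuousLinearEquiv 2 𝕜 E F).symm
  intro x hx
  have hmem : e x ∈ (g.map e.toLinearMap)ᗮᗮ := by
    refine (Submodule.mem_orthogonal _ _).2 fun z hz => ?_
    have hz' : (z.snd, -z.fst) ∈ g.adjoint := by
      rw [Submodule.mem_adjoint_iff]
      intro a b hab
      have h0 := (Submodule.mem_orthogonal _ _).1 hz _ (Submodule.mem_map_of_mem hab)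
      simpa [e, WithLp.prod_inner_apply, add_comm] using h0
    have h0 := (Submodule.mem_adjoint_iff _ x).1 hx _ _ hz'
    rw [sub_eq_zero] at h0
    simp [e, WithLp.prod_inner_apply, ← h0]
  rw [Submodule.orthogonal_orthogonal_eq_closure] at hmem
  have hcl : e.symm (e x) ∈ closure (e.symm '' (g.map e.toLinearMap : Set _)) :=
    image_closure_subset_closure_image e.symm.continuous (Set.mem_image_of_mem _ hmem)
  rw [← SetLike.mem_coe, Submodule.topologicalClosure_coe]
  simpa [Set.image_image] using hcl

variable {A : E →ₗ.[𝕜] E}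

lemma le_adjoint_of_isSelfAdjoint_adjoint (hA : Dense (A.domain : Set E))
    (h : IsSelfAdjoint A.adjoint) : A ≤ A.adjoint := by
  have hle : A ≤ A.adjoint.adjoint :=
    (LinearPMap.adjoint_isFormalAdjoint hA).le_adjoint h.dense_domain
  rwa [LinearPMap.isSelfAdjoint_def.1 h] at hle

lemma isClosable_of_isSelfAdjoint_adjoint (hA : Dense (A.domain : Set E))
    (h : IsSelfAdjoint A.adjoint) : A.IsClosable :=
  LinearPMap.isClosable_iff_exists_closed_extension.2
    ⟨A.adjoint, LinearPMap.adjoint_isClosed hA, le_adjoint_of_isSelfAdjoint_adjoint hA h⟩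

lemma closure_eq_adjoint_of_isSelfAdjoint_adjoint (hA : Dense (A.domain : Set E))
    (h : IsSelfAdjoint A.adjoint) : A.closure = A.adjoint := by
  refine LinearPMap.eq_of_eq_graph (le_antisymm ?_ ?_) <;>
    rw [← (isClosable_of_isSelfAdjoint_adjoint hA h).graph_closure_eq_closure_graph]
  · exact Submodule.topologicalClosure_minimal _
      (LinearPMap.le_graph_of_le (le_adjoint_of_isSelfAdjoint_adjoint hA h))
      (LinearPMap.adjoint_isClosed hA)
  · rw [← LinearPMap.isSelfAdjoint_def.1 h,
      LinearPMap.adjoint_graph_eq_graph_adjoint h.dense_domain,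
      LinearPMap.adjoint_graph_eq_graph_adjoint hA]
    exact adjoint_adjoint_le_topologicalClosure A.graph

end Adjoint

section WeakDerivative

variable {H : Type*} [NormedAddCommGroup H] [InnerProductSpace ℂ H] [CompleteSpace H]

lemma hasDerivAt_of_hasDerivAt_inner {D : Set H} (hD : Dense D) {f f' : ℝ → H}
    (hf' : Continuous f')
    (h : ∀ ψ ∈ D, ∀ t, HasDerivAt (fun s => ⟪ψ, f s⟫_ℂ) ⟪ψ, f' t⟫_ℂ t) (t : ℝ) :
    HasDerivAt f (f' t) t := by
  have hprim : ∀ t, HasDerivAt (fun s => ∫ r in (0 : ℝ)..s, f' r) (f' t) t := fun t =>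
    hf'.integral_hasStrictDerivAt 0 t |>.hasDerivAt
  have hconst : ∀ s, f s - ∫ r in (0 : ℝ)..s, f' r = f 0 := by
    intro s
    refine hD.eq_of_inner_right ℂ fun ψ hψ => ?_
    have hzero : ∀ t, HasDerivAt (fun s => ⟪ψ, f s - ∫ r in (0 : ℝ)..s, f' r⟫_ℂ) 0 t := by
      intro t
      simpa [inner_sub_right] using
        (h ψ hψ t).fun_sub ((hasDerivAt_const t ψ).inner ℂ (hprim t))
    simpa [inner_sub_right] using is_const_of_deriv_eq_zero
      (fun t => (hzero t).differentiableAt) (fun t => (hzero t).deriv) s 0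
  exact ((hprim t).const_add (f 0)).congr_of_eventuallyEq
    (Eventually.of_forall fun s => sub_eq_iff_eq_add.1 (hconst s))

end WeakDerivative

section InvariantCore

variable {H : Type*} [NormedAddCommGroup H] [InnerProductSpace ℂ H]

/-- `A` is the restriction of the generator of the unitary group `T` to a dense subspace that is
invariant under `T`. Such an `A` is essentially self-adjoint, with the generator as its closure. -/
structure IsInvariantCore (A : H →ₗ.[ℂ] H) (T : ℝ → H ≃ₗᵢ[ℂ] H) : Prop where
  group : IsUnitaryRep T
  dense : Dense (A.domain : Set H)
  mapsTo : ∀ t, ∀ ψ ∈ A.domain, T t ψ ∈ A.domain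
  generatesAt : ∀ ψ φ, (ψ, φ) ∈ A.graph → GeneratesAt T ψ φ

namespace IsInvariantCore

variable {A : H →ₗ.[ℂ] H} {T : ℝ → H ≃ₗᵢ[ℂ] H} (h : IsInvariantCore A T)
include h

lemma map_graph {ψ φ : H} (hψ : (ψ, φ) ∈ A.graph) (t : ℝ) : (T t ψ, T t φ) ∈ A.graph := by
  have hdom := h.mapsTo t ψ (LinearPMap.mem_domain_of_mem_graph hψ)
  obtain ⟨η, hη⟩ := LinearPMap.mem_domain_iff.1 hdom
  rwa [← (h.generatesAt _ _ hη).unique (h.group.generatesAt_apply (h.generatesAt _ _ hψ) t)]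

lemma eq_of_generatesAt {S : ℝ → H ≃ₗᵢ[ℂ] H} (hS : IsUnitaryRep S)
    (hgen : ∀ ψ φ, (ψ, φ) ∈ A.graph → GeneratesAt S ψ φ) (t : ℝ) : S t = T t := by
  have hinner : ∀ ψ ∈ A.domain, ∀ χ ∈ A.domain, ⟪S t ψ, T t χ⟫_ℂ = ⟪ψ, χ⟫_ℂ := by
    intro ψ hψ χ hχ
    obtain ⟨φ, hφ⟩ := LinearPMap.mem_domain_iff.1 hψ
    obtain ⟨η, hη⟩ := LinearPMap.mem_domain_iff.1 hχ
    have hderiv : ∀ s : ℝ, HasDerivAt (fun s => ⟪S s ψ, T s χ⟫_ℂ) 0 s := by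
      intro s
      have hsymm := hS.inner_left_eq_inner_right (hS.generatesAt_apply (hgen _ _ hφ) s)
        (hgen _ _ (h.map_graph hη s))
      have hprod := (hS.hasDerivAt (hgen _ _ hφ) s).inner ℂ
        (h.group.hasDerivAt (h.generatesAt _ _ hη) s)
      simpa [inner_smul_left, inner_smul_right, hsymm] using hprod
    simpa [hS.map_zero, h.group.map_zero] using
      is_const_of_deriv_eq_zero (fun s => (hderiv s).differentiableAt)
        (fun s => (hderiv s).deriv) t 0
  have hinner' : ∀ ψ ∈ A.domain, ∀ χ, ⟪S t ψ, T t χ⟫_ℂ = ⟪ψ, χ⟫_ℂ := fun ψ hψ =>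
    h.dense.induction (hinner ψ hψ) (isClosed_eq (by fun_prop) (by fun_prop))
  ext ψ
  refine h.dense.induction (P := fun ψ => S t ψ = T t ψ) (fun ψ hψ => ?_)
    (isClosed_eq (by fun_prop) (by fun_prop)) ψ
  refine ext_inner_right ℂ ((T t).surjective.forall.2 fun χ => ?_)
  rw [hinner' ψ hψ, LinearIsometryEquiv.inner_map_map]

variable [CompleteSpace H]

lemma hasDerivAt_of_mem_graph_adjoint {φ η : H} (hφ : (φ, η) ∈ A.adjoint.graph) (t : ℝ) :
    HasDerivAt (fun s => T s φ) (Complex.I • T t η) t := by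
  rw [LinearPMap.adjoint_graph_eq_graph_adjoint h.dense, Submodule.mem_adjoint_iff] at hφ
  refine hasDerivAt_of_hasDerivAt_inner (f' := fun t => Complex.I • T t η) h.dense
    ((h.group.continuous η).const_smul _) (fun ψ hψ t => ?_) t
  obtain ⟨χ, hχ⟩ := LinearPMap.mem_domain_iff.1 hψ
  have hadj := sub_eq_zero.1 (hφ _ _ (h.map_graph hχ (-t)))
  rw [h.group.inner_apply_left, h.group.inner_apply_left, neg_neg] at hadj
  have hderiv := (h.group.hasDerivAt_neg (h.generatesAt _ _ hχ) t).inner ℂ (hasDerivAt_const t φ)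
  simpa [inner_smul_left, inner_smul_right, h.group.inner_apply_left, hadj] using hderiv

theorem mem_graph_adjoint_iff {φ η : H} : (φ, η) ∈ A.adjoint.graph ↔ GeneratesAt T φ η := by
  refine ⟨fun hφ => ?_, fun hφ => ?_⟩
  · have hderiv := h.hasDerivAt_of_mem_graph_adjoint hφ 0
    rwa [h.group.map_zero, LinearIsometryEquiv.coe_one, id_eq,
      ← h.group.generatesAt_iff_hasDerivAt] at hderiv
  · rw [LinearPMap.adjoint_graph_eq_graph_adjoint h.dense, Submodule.mem_adjoint_iff]
    exact fun ψ χ hψ =>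
      sub_eq_zero.2 (h.group.inner_left_eq_inner_right (h.generatesAt _ _ hψ) hφ)

lemma le_adjoint : A ≤ A.adjoint :=
  LinearPMap.le_of_le_graph fun _ hx => h.mem_graph_adjoint_iff.2 (h.generatesAt _ _ hx)

lemma isSelfAdjoint_adjoint : IsSelfAdjoint A.adjoint := by
  rw [LinearPMap.isSelfAdjoint_def]
  have hcore : IsInvariantCore A.adjoint T :=
    { group := h.group
      dense := h.dense.mono h.le_adjoint.1
      mapsTo := fun t ψ hψ => by
        obtain ⟨φ, hφ⟩ := LinearPMap.mem_domain_iff.1 hψ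
        exact LinearPMap.mem_domain_of_mem_graph
          (h.mem_graph_adjoint_iff.2 (h.group.generatesAt_apply (h.mem_graph_adjoint_iff.1 hφ) t))
      generatesAt := fun ψ φ => h.mem_graph_adjoint_iff.1 }
  refine LinearPMap.eq_of_eq_graph (Submodule.ext fun ⟨ψ, φ⟩ => ?_)
  rw [hcore.mem_graph_adjoint_iff, h.mem_graph_adjoint_iff]

theorem isEssentiallySelfAdjoint : IsEssentiallySelfAdjoint A := by
  refine ⟨h.dense, isClosable_of_isSelfAdjoint_adjoint h.dense h.isSelfAdjoint_adjoint, ?_⟩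
  rw [closure_eq_adjoint_of_isSelfAdjoint_adjoint h.dense h.isSelfAdjoint_adjoint]
  exact h.isSelfAdjoint_adjoint

theorem mem_graph_closure_iff {ψ φ : H} : (ψ, φ) ∈ A.closure.graph ↔ GeneratesAt T ψ φ := by
  rw [closure_eq_adjoint_of_isSelfAdjoint_adjoint h.dense h.isSelfAdjoint_adjoint,
    h.mem_graph_adjoint_iff]

theorem isExpI : IsExpI A.closure (T 1) :=
  ⟨T, h.group.map_zero, h.group.map_add, h.group.continuous,
    fun _ _ => h.mem_graph_closure_iff, rfl⟩

omit [CompleteSpace H] in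
theorem isExpI_unique {W : H ≃ₗᵢ[ℂ] H} (hW : IsExpI A.closure W) : W = T 1 := by
  obtain ⟨S, hzero, hadd, hcont, hgen, rfl⟩ := hW
  exact h.eq_of_generatesAt ⟨hzero, hadd, hcont⟩
    (fun ψ φ hψ => (hgen ψ φ).1 (LinearPMap.le_graph_of_le A.le_closure hψ)) 1

end IsInvariantCore

end InvariantCore

/-! ### Operators integrated by a unitary representation of `ℝ^d` -/

section Graphs

variable {R E F : Type*} [Ring R] [AddCommGroup E] [Module R E] [AddCommGroup F] [Module R F]

lemma mem_graph_add_iff {f g : E →ₗ.[R] F} {x : E} {y : F} :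
    (x, y) ∈ (f + g).graph ↔ ∃ a b, (x, a) ∈ f.graph ∧ (x, b) ∈ g.graph ∧ y = a + b := by
  simp only [LinearPMap.mem_graph_iff]
  constructor
  · rintro ⟨z, rfl, rfl⟩
    exact ⟨_, _, ⟨⟨z, z.2.1⟩, rfl, rfl⟩, ⟨⟨z, z.2.2⟩, rfl, rfl⟩, rfl⟩
  · rintro ⟨-, -, ⟨⟨_, hf⟩, rfl, rfl⟩, ⟨⟨_, hg⟩, rfl, rfl⟩, rfl⟩
    exact ⟨⟨_, hf, hg⟩, rfl, rfl⟩

lemma mem_graph_sum_iff {ι : Type*} {s : Finset ι} {f : ι → E →ₗ.[R] F} {x : E} {y : F} :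
    (x, y) ∈ (∑ i ∈ s, f i).graph ↔
      ∃ a : ι → F, (∀ i ∈ s, (x, a i) ∈ (f i).graph) ∧ y = ∑ i ∈ s, a i := by
  classical
  induction s using Finset.induction_on generalizing y with
  | empty => simp [eq_comm]
  | insert i s hi ih =>
    simp only [Finset.sum_insert hi, mem_graph_add_iff, Finset.forall_mem_insert]
    constructor
    · rintro ⟨a, b, ha, hb, rfl⟩
      obtain ⟨c, hc, rfl⟩ := ih.1 hb
      have hupdate : ∀ j ∈ s, Function.update c i a j = c j := fun j hj =>
        Function.update_of_ne (ne_of_mem_of_not_mem hj hi) _ _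
      refine ⟨Function.update c i a, ⟨by simpa using ha, fun j hj => ?_⟩, ?_⟩
      · simpa only [hupdate j hj] using hc j hj
      · rw [Function.update_self, Finset.sum_congr rfl hupdate]
    · rintro ⟨a, ⟨hi, hs⟩, rfl⟩
      exact ⟨a i, _, hi, ih.2 ⟨a, hs, rfl⟩, rfl⟩

lemma mem_graph_domRestrict_iff {f : E →ₗ.[R] F} {D : Submodule R E} {x : E} {y : F} :
    (x, y) ∈ (f.domRestrict D).graph ↔ x ∈ D ∧ (x, y) ∈ f.graph := by
  simp only [LinearPMap.mem_graph_iff]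
  constructor
  · rintro ⟨z, rfl, rfl⟩
    exact ⟨z.2.1, ⟨z, z.2.2⟩, rfl, rfl⟩
  · rintro ⟨hD, z, rfl, rfl⟩
    exact ⟨⟨z, hD, z.2⟩, rfl, rfl⟩

lemma mem_graph_smul_iff {M : Type*} [Monoid M] [DistribMulAction M F] [SMulCommClass R M F]
    {f : E →ₗ.[R] F} {c : M} {x : E} {y : F} :
    (x, y) ∈ (c • f).graph ↔ ∃ a, (x, a) ∈ f.graph ∧ y = c • a := by
  simp only [LinearPMap.mem_graph_iff]
  constructor
  · rintro ⟨z, rfl, rfl⟩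
    exact ⟨_, ⟨z, rfl, rfl⟩, rfl⟩
  · rintro ⟨-, ⟨z, rfl, rfl⟩, rfl⟩
    exact ⟨z, rfl, rfl⟩

end Graphs

section Contraction

variable {H : Type*} [NormedAddCommGroup H] [InnerProductSpace ℂ H] {d : ℕ}
  {X : Fin d → (H →ₗ.[ℂ] H)} {D : Submodule ℂ H} {p : Fin d → ℝ}

lemma mem_graph_contraction_iff {ψ φ : H} :
    (ψ, φ) ∈ (contraction X D p).graph ↔
      ∃ a : Fin d → H, (∀ μ, ψ ∈ D ∧ (ψ, a μ) ∈ (X μ).graph) ∧ φ = ∑ μ, (p μ : ℂ) • a μ := by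
  simp only [contraction, mem_graph_sum_iff, mem_graph_smul_iff, mem_graph_domRestrict_iff,
    Finset.mem_univ, true_implies]
  constructor
  · rintro ⟨b, hb, rfl⟩
    choose a ha hab using hb
    exact ⟨a, ha, Finset.sum_congr rfl fun μ _ => hab μ⟩
  · rintro ⟨a, ha, rfl⟩
    exact ⟨_, fun μ => ⟨a μ, ha μ, rfl⟩, rfl⟩

lemma domain_contraction [NeZero d] (hD : ∀ μ, D ≤ (X μ).domain) :
    (contraction X D p).domain = D := by
  ext ψ
  simp only [LinearPMap.mem_domain_iff, mem_graph_contraction_iff]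
  constructor
  · rintro ⟨-, a, ha, -⟩
    exact (ha 0).1
  · intro hψ
    choose a ha using fun μ => LinearPMap.mem_domain_iff.1 (hD μ hψ)
    exact ⟨_, a, fun μ => ⟨hψ, ha μ⟩, rfl⟩

end Contraction

section Integrates

variable {H : Type*} [NormedAddCommGroup H] [InnerProductSpace ℂ H] {d : ℕ}

/-- `U` is a strongly continuous unitary representation of `ℝ^d` which leaves the dense domain `D`
invariant, and whose generators act on `D` as the operators `X μ`, which leave `D` invariant. The
notion is stable under unitary equivalence, direct sums and restriction to invariant subspaces, and
implies all the asserted properties of the `X μ`. -/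
structure Integrates (U : (Fin d → ℝ) → (H ≃ₗᵢ[ℂ] H)) (X : Fin d → (H →ₗ.[ℂ] H))
    (D : Submodule ℂ H) : Prop where
  rep : IsUnitaryRep U
  dense : Dense (D : Set H)
  mapsTo : ∀ p, ∀ ψ ∈ D, U p ψ ∈ D
  exists_generatesAt : ∀ ψ ∈ D, ∃ φ : Fin d → H, (∀ μ, φ μ ∈ D ∧ (ψ, φ μ) ∈ (X μ).graph) ∧
    ∀ p, GeneratesAt (fun t : ℝ => U (t • p)) ψ (∑ μ, (p μ : ℂ) • φ μ)

namespace Integrates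

variable {U : (Fin d → ℝ) → (H ≃ₗᵢ[ℂ] H)} {X : Fin d → (H →ₗ.[ℂ] H)} {D : Submodule ℂ H}
  (h : Integrates U X D)
include h

lemma le_domain (μ : Fin d) : D ≤ (X μ).domain := fun ψ hψ => by
  obtain ⟨φ, hφ, -⟩ := h.exists_generatesAt ψ hψ
  exact LinearPMap.mem_domain_of_mem_graph (hφ μ).2

lemma mem_of_graph {μ : Fin d} {ψ φ : H} (hψ : ψ ∈ D) (hφ : (ψ, φ) ∈ (X μ).graph) : φ ∈ D := by
  obtain ⟨φ', hφ', -⟩ := h.exists_generatesAt ψ hψ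
  rw [LinearPMap.mem_graph_snd_inj _ hφ (hφ' μ).2 rfl]
  exact (hφ' μ).1

lemma generatesAt {ψ : H} (hψ : ψ ∈ D) {φ : Fin d → H} (hφ : ∀ μ, (ψ, φ μ) ∈ (X μ).graph)
    (p : Fin d → ℝ) : GeneratesAt (fun t : ℝ => U (t • p)) ψ (∑ μ, (p μ : ℂ) • φ μ) := by
  obtain ⟨φ', hφ', hgen⟩ := h.exists_generatesAt ψ hψ
  have hφφ' : φ = φ' := funext fun μ => LinearPMap.mem_graph_snd_inj _ (hφ μ) (hφ' μ).2 rfl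
  exact hφφ' ▸ hgen p

lemma generatesAt_single {μ : Fin d} {ψ φ : H} (hψ : ψ ∈ D) (hφ : (ψ, φ) ∈ (X μ).graph) :
    GeneratesAt (fun t : ℝ => U (t • Pi.single μ 1)) ψ φ := by
  obtain ⟨φ', hφ', hgen⟩ := h.exists_generatesAt ψ hψ
  rw [LinearPMap.mem_graph_snd_inj _ hφ (hφ' μ).2 rfl]
  simpa [Pi.single_apply, ite_smul] using hgen (Pi.single μ 1)

lemma isInvariantCore_contraction [NeZero d] (p : Fin d → ℝ) :
    IsInvariantCore (contraction X D p) fun t : ℝ => U (t • p) where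
  group := h.rep.comp_smul p
  dense := by rw [domain_contraction h.le_domain]; exact h.dense
  mapsTo := by rw [domain_contraction h.le_domain]; exact fun t => h.mapsTo _
  generatesAt ψ φ hψ := by
    obtain ⟨a, ha, rfl⟩ := mem_graph_contraction_iff.1 hψ
    exact h.generatesAt (ha 0).1 (fun μ => (ha μ).2) p

lemma isInvariantCore_domRestrict (μ : Fin d) :
    IsInvariantCore ((X μ).domRestrict D) fun t : ℝ => U (t • Pi.single μ 1) where
  group := h.rep.comp_smul _
  dense := h.dense.mono fun ψ hψ => ⟨hψ, h.le_domain μ hψ⟩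
  mapsTo t ψ hψ := ⟨h.mapsTo _ ψ hψ.1, h.le_domain μ (h.mapsTo _ ψ hψ.1)⟩
  generatesAt ψ φ hψ := by
    obtain ⟨hD, hφ⟩ := mem_graph_domRestrict_iff.1 hψ
    exact h.generatesAt_single hD hφ

lemma commuteOn (μ ν : Fin d) : CommuteOn (X μ) (X ν) D := by
  intro ψ hψ
  have hgen : ∀ (ρ : Fin d) {χ : H} (hχ : χ ∈ D), GeneratesAt
      (fun t : ℝ => U (t • Pi.single ρ 1)) χ (X ρ ⟨χ, h.le_domain ρ hχ⟩) := fun ρ χ hχ =>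
    h.generatesAt_single hχ ((X ρ).mem_graph ⟨χ, h.le_domain ρ hχ⟩)
  have hmem : ∀ ρ : Fin d, X ρ ⟨ψ, h.le_domain ρ hψ⟩ ∈ D := fun ρ =>
    h.mem_of_graph hψ ((X ρ).mem_graph ⟨ψ, h.le_domain ρ hψ⟩)
  refine ⟨h.le_domain μ hψ, h.le_domain ν hψ, h.le_domain μ (hmem ν), h.le_domain ν (hmem μ),
    sub_eq_zero.2 ?_⟩
  exact (h.rep.comp_smul _).eq_of_commute (h.rep.comp_smul _) (fun s t => h.rep.commute _ _)
    h.dense (fun χ hχ => ⟨_, hgen ν hχ⟩) (hgen μ hψ) (hgen ν hψ) (hgen μ (hmem ν))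
    (hgen ν (hmem μ))

variable [CompleteSpace H]

theorem isCommutingEssSelfAdjoint : IsCommutingEssSelfAdjoint X D where
  dense := h.dense
  le_domain := h.le_domain
  essSelfAdjoint μ := (h.isInvariantCore_domRestrict μ).isEssentiallySelfAdjoint
  mapsTo μ ψ hψ := h.mem_of_graph hψ ((X μ).mem_graph ψ)
  commute := h.commuteOn

theorem generatesUnitaryGroup [NeZero d] : GeneratesUnitaryGroup X D := by
  refine ⟨fun p => (h.isInvariantCore_contraction p).isEssentiallySelfAdjoint, U,
    fun p => ⟨?_, fun W hW => ?_⟩, h.rep.map_zero, h.rep.map_add, h.rep.continuous⟩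
  · simpa only [one_smul] using (h.isInvariantCore_contraction p).isExpI
  · simpa only [one_smul] using (h.isInvariantCore_contraction p).isExpI_unique hW

end Integrates

/-! ### Unitary equivalence, invariant subspaces and direct sums -/

section Conjugation

variable {U : (Fin d → ℝ) → (H ≃ₗᵢ[ℂ] H)} {X : Fin d → (H →ₗ.[ℂ] H)} {D : Submodule ℂ H}

lemma mem_graph_sandwich_iff {W : H ≃ₗᵢ[ℂ] H} {A : H →ₗ.[ℂ] H} {ψ φ : H} :
    (ψ, φ) ∈ (sandwich W.symm A W).graph ↔ (W ψ, W φ) ∈ A.graph := by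
  simp only [LinearPMap.mem_graph_iff]
  constructor
  · rintro ⟨x, rfl, rfl⟩
    exact ⟨⟨W x, x.2⟩, rfl, (W.apply_symm_apply _).symm⟩
  · rintro ⟨⟨_, hx⟩, rfl, hφ⟩
    exact ⟨⟨ψ, hx⟩, rfl, W.symm_apply_eq.2 hφ⟩

lemma IsUnitaryRep.conj {G : Type*} [AddMonoid G] [TopologicalSpace G] {U : G → H ≃ₗᵢ[ℂ] H}
    (hU : IsUnitaryRep U) (W : H ≃ₗᵢ[ℂ] H) : IsUnitaryRep fun g => W⁻¹ * U g * W where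
  map_zero := by rw [hU.map_zero, mul_one, inv_mul_cancel]
  map_add g h := by rw [hU.map_add]; group
  continuous ψ := W.symm.continuous.comp (hU.continuous (W ψ))

theorem Integrates.sandwich (h : Integrates U X D) (W : H ≃ₗᵢ[ℂ] H) :
    Integrates (fun p => W⁻¹ * U p * W) (fun μ => sandwich W.symm (X μ) W)
      (D.map W.symm.toLinearEquiv.toLinearMap) where
  rep := h.rep.conj W
  dense := W.symm.surjective.denseRange.dense_image W.symm.continuous h.dense
  mapsTo := by
    rintro p _ ⟨ψ, hψ, rfl⟩
    exact ⟨U p ψ, h.mapsTo p ψ hψ, congrArg (fun χ => W.symm (U p χ)) (W.apply_symm_apply ψ).symm⟩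
  exists_generatesAt := by
    rintro _ ⟨ψ, hψ, rfl⟩
    obtain ⟨φ, hφ, hgen⟩ := h.exists_generatesAt ψ hψ
    refine ⟨fun μ => W.symm (φ μ), fun μ => ⟨⟨φ μ, (hφ μ).1, rfl⟩, ?_⟩, fun p => ?_⟩
    · rw [mem_graph_sandwich_iff, W.apply_symm_apply]
      exact (congrArg (fun χ => (χ, φ μ) ∈ (X μ).graph) (W.apply_symm_apply ψ)).mpr (hφ μ).2
    · have hmap := (hgen p).map (S := fun t => W⁻¹ * U (t • p) * W)
        W.symm.toContinuousLinearEquiv.toContinuousLinearMap fun t =>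
          congrArg (fun χ => W.symm (U (t • p) χ)) (W.apply_symm_apply ψ)
      simp only [map_sum, map_smul] at hmap
      exact hmap

end Conjugation

section Restriction

lemma mem_graph_part_iff {A : H →ₗ.[ℂ] H} {K : Submodule ℂ H} {ψ φ : K} :
    (ψ, φ) ∈ (part A K).graph ↔ ((ψ : H), (φ : H)) ∈ A.graph := by
  simp only [LinearPMap.mem_graph_iff]
  constructor
  · rintro ⟨x, rfl, rfl⟩
    exact ⟨⟨x.1, x.2.1⟩, rfl, rfl⟩
  · rintro ⟨⟨_, hx⟩, rfl, hφ⟩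
    exact ⟨⟨ψ, hx, hφ ▸ φ.2⟩, rfl, Subtype.ext hφ⟩

/-- The restriction of a unitary representation to an invariant subspace. -/
def IsUnitaryRep.restrict {G : Type*} [AddGroup G] [TopologicalSpace G] {U : G → H ≃ₗᵢ[ℂ] H}
    (hU : IsUnitaryRep U) (K : Submodule ℂ H) (hK : ∀ g, ∀ ψ ∈ K, U g ψ ∈ K) (g : G) :
    K ≃ₗᵢ[ℂ] K where
  toFun ψ := ⟨U g ψ, hK g ψ ψ.2⟩
  invFun ψ := ⟨U (-g) ψ, hK (-g) ψ ψ.2⟩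
  left_inv ψ := Subtype.ext <| by
    change U (-g) (U g ψ) = ψ
    rw [← hU.add_apply, neg_add_cancel, hU.map_zero, LinearIsometryEquiv.coe_one, id_eq]
  right_inv ψ := Subtype.ext <| by
    change U g (U (-g) ψ) = ψ
    rw [← hU.add_apply, add_neg_cancel, hU.map_zero, LinearIsometryEquiv.coe_one, id_eq]
  map_add' ψ φ := Subtype.ext (_root_.map_add (U g) ψ.1 φ.1)
  map_smul' c ψ := Subtype.ext (_root_.map_smul (U g) c ψ.1)
  norm_map' ψ := (U g).norm_map ψ.1

lemma IsUnitaryRep.coe_restrict_apply {G : Type*} [AddGroup G] [TopologicalSpace G]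
    {U : G → H ≃ₗᵢ[ℂ] H} (hU : IsUnitaryRep U) {K : Submodule ℂ H}
    (hK : ∀ g, ∀ ψ ∈ K, U g ψ ∈ K) (g : G) (ψ : K) : (hU.restrict K hK g ψ : H) = U g ψ := rfl

lemma IsUnitaryRep.isUnitaryRep_restrict {G : Type*} [AddGroup G] [TopologicalSpace G]
    {U : G → H ≃ₗᵢ[ℂ] H} (hU : IsUnitaryRep U) (K : Submodule ℂ H)
    (hK : ∀ g, ∀ ψ ∈ K, U g ψ ∈ K) : IsUnitaryRep (hU.restrict K hK) where
  map_zero := by ext ψ; exact DFunLike.congr_fun hU.map_zero ψ.1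
  map_add g h := by ext ψ; exact DFunLike.congr_fun (hU.map_add g h) ψ.1
  continuous ψ := (hU.continuous ψ.1).subtype_mk _

lemma GeneratesAt.mem_of_isClosed {T : ℝ → H ≃ₗᵢ[ℂ] H} {ψ φ : H} (h : GeneratesAt T ψ φ)
    {K : Submodule ℂ H} (hclosed : IsClosed (K : Set H)) (hK : ∀ t, T t ψ ∈ K) (hψ : ψ ∈ K) :
    φ ∈ K :=
  (K.smul_mem_iff Complex.I_ne_zero).1 <| hclosed.mem_of_tendsto h <|
    Eventually.of_forall fun t => K.smul_mem _ (K.sub_mem (hK t) hψ)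

theorem Integrates.part {U : (Fin d → ℝ) → (H ≃ₗᵢ[ℂ] H)} {X : Fin d → (H →ₗ.[ℂ] H)}
    {D : Submodule ℂ H} (h : Integrates U X D) {K : Submodule ℂ H} [CompleteSpace K]
    (hK : ∀ p, ∀ ψ ∈ K, U p ψ ∈ K)
    (hdense : Dense (D.comap K.subtype : Set K)) :
    Integrates (h.rep.restrict K hK) (fun μ => part (X μ) K) (D.comap K.subtype) where
  rep := h.rep.isUnitaryRep_restrict K hK
  dense := hdense
  mapsTo p ψ hψ := h.mapsTo p ψ.1 hψ
  exists_generatesAt ψ hψ := by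
    have hclosed : IsClosed (K : Set H) :=
      (completeSpace_coe_iff_isComplete.1 ‹CompleteSpace K›).isClosed
    obtain ⟨φ, hφ, hgen⟩ := h.exists_generatesAt ψ.1 hψ
    have hφK : ∀ μ, φ μ ∈ K := fun μ =>
      (h.generatesAt_single hψ (hφ μ).2).mem_of_isClosed hclosed (fun t => hK _ _ ψ.2) ψ.2
    refine ⟨fun μ => ⟨φ μ, hφK μ⟩, fun μ => ⟨(hφ μ).1, mem_graph_part_iff.2 (hφ μ).2⟩, fun p => ?_⟩
    rw [GeneratesAt, tendsto_subtype_rng]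
    simpa only [GeneratesAt, Submodule.coe_smul, Submodule.coe_sub, Submodule.coe_sum,
      IsUnitaryRep.coe_restrict_apply] using hgen p

end Restriction

end Integrates

section DirectSum

variable {E : ℕ → Type*} [∀ k, NormedAddCommGroup (E k)] [∀ k, InnerProductSpace ℂ (E k)]
  {D : ∀ k, Submodule ℂ (E k)}

lemma single_mem_finiteSum {k : ℕ} {x : E k} (hx : x ∈ D k) : lp.single 2 k x ∈ finiteSum D := by
  refine ⟨fun j => ?_, (Set.finite_singleton k).subset fun j hj => ?_⟩
  · rcases eq_or_ne j k with rfl | hjk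
    · rwa [lp.single_apply_self]
    · rw [lp.single_apply_ne _ _ _ hjk]
      exact (D j).zero_mem
  · by_contra hjk
    exact hj (lp.single_apply_ne _ _ _ hjk)

lemma finiteSum_induction {P : ∀ ψ ∈ finiteSum D, Prop} (zero : P 0 (zero_mem _))
    (add : ∀ ψ φ hψ hφ, P ψ hψ → P φ hφ → P (ψ + φ) (add_mem hψ hφ))
    (single : ∀ k x (hx : x ∈ D k), P (lp.single 2 k x) (single_mem_finiteSum hx))
    {ψ : lp E 2} (hψ : ψ ∈ finiteSum D) : P ψ hψ := by
  have hsum : ψ = ∑ k ∈ hψ.2.toFinset, lp.single 2 k (ψ k) := by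
    ext j
    simp only [lp.coeFn_sum, lp.coeFn_single, Finset.sum_apply, Finset.sum_pi_single]
    split_ifs with hj
    · rfl
    · exact not_not.1 (mt hψ.2.mem_toFinset.2 hj)
  suffices h : ∃ hψ : ψ ∈ finiteSum D, P ψ hψ from h.2
  rw [hsum]
  exact Finset.sum_induction _ (fun ψ => ∃ hψ : ψ ∈ finiteSum D, P ψ hψ)
    (fun _ _ h h' => ⟨_, add _ _ _ _ h.2 h'.2⟩) ⟨_, zero⟩ fun k _ => ⟨_, single k _ (hψ.1 k)⟩

lemma mem_topologicalClosure_finiteSum {ψ : lp E 2}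
    (hψ : ∀ k, ψ k ∈ (D k).topologicalClosure) : ψ ∈ (finiteSum D).topologicalClosure := by
  have hsingle : ∀ k, lp.single 2 k (ψ k) ∈ (finiteSum D).topologicalClosure := fun k =>
    map_mem_closure (lp.singleContinuousLinearMap ℂ E 2 k).continuous (hψ k)
      fun _ => single_mem_finiteSum
  exact (finiteSum D).isClosed_topologicalClosure.mem_of_tendsto
    (lp.hasSum_single ENNReal.ofNat_ne_top ψ)
    (Eventually.of_forall fun s => Submodule.sum_mem _ fun k _ => hsingle k)

lemma dense_finiteSum (hD : ∀ k, Dense (D k : Set (E k))) : Dense (finiteSum D : Set (lp E 2)) :=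
  fun _ => mem_topologicalClosure_finiteSum fun k => hD k _

lemma directSumUnitary_single (W : ∀ k, E k ≃ₗᵢ[ℂ] E k) (k : ℕ) (x : E k) :
    directSumUnitary W (lp.single 2 k x) = lp.single 2 k (W k x) := by
  ext j
  exact Pi.apply_single (fun j => W j) (fun j => map_zero (W j)) k x j

lemma mem_graph_directSumOp_iff {A : ∀ k, E k →ₗ.[ℂ] E k} {ψ φ : lp E 2} :
    (ψ, φ) ∈ (directSumOp A).graph ↔ ∀ k, (ψ k, φ k) ∈ (A k).graph := by
  constructor
  · intro h k
    obtain ⟨x, rfl, rfl⟩ := (LinearPMap.mem_graph_iff _).1 h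
    exact (A k).mem_graph ⟨x.1 k, x.2.1 k⟩
  · intro h
    have hdom : ∀ k, ψ k ∈ (A k).domain := fun k => LinearPMap.mem_domain_of_mem_graph (h k)
    have hval : ∀ k, A k ⟨ψ k, hdom k⟩ = φ k := fun k =>
      ((LinearPMap.image_iff (hdom k)).2 (h k)).symm
    have hmem : Memℓp (fun k => A k ⟨ψ k, hdom k⟩) 2 := by
      simpa only [hval] using lp.memℓp φ
    exact (LinearPMap.mem_graph_iff _).2 ⟨⟨ψ, hdom, hmem⟩, rfl, lp.ext (funext hval)⟩

lemma single_mem_graph_directSumOp {A : ∀ k, E k →ₗ.[ℂ] E k} {k : ℕ} {x y : E k}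
    (h : (x, y) ∈ (A k).graph) : (lp.single 2 k x, lp.single 2 k y) ∈ (directSumOp A).graph := by
  rw [mem_graph_directSumOp_iff]
  intro j
  rcases eq_or_ne j k with rfl | hjk
  · simpa only [lp.single_apply_self] using h
  · rw [lp.single_apply_ne _ _ _ hjk, lp.single_apply_ne _ _ _ hjk]
    exact (A j).graph.zero_mem

lemma continuous_unitary_apply_of_dense {Y H : Type*} [TopologicalSpace Y] [NormedAddCommGroup H]
    [InnerProductSpace ℂ H] {W : Y → H ≃ₗᵢ[ℂ] H} {S : Set H} (hS : Dense S)
    (h : ∀ ψ ∈ S, Continuous fun y => W y ψ) (ψ : H) : Continuous fun y => W y ψ :=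
  (continuous_prod_of_dense_continuous_lipschitzWith' (fun x : Y × H => W x.1 x.2) 1 hS
    (fun y => (W y).lipschitz) h).comp (by fun_prop : Continuous fun y => (y, ψ))

lemma isUnitaryRep_directSumUnitary {G : Type*} [AddMonoid G] [TopologicalSpace G]
    {U : ∀ k, G → (E k ≃ₗᵢ[ℂ] E k)} (hU : ∀ k, IsUnitaryRep (U k)) :
    IsUnitaryRep fun g => directSumUnitary fun k => U k g where
  map_zero := by
    ext ψ k
    exact DFunLike.congr_fun (hU k).map_zero (ψ k)
  map_add g h := by
    ext ψ k
    exact DFunLike.congr_fun ((hU k).map_add g h) (ψ k)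
  continuous := by
    refine continuous_unitary_apply_of_dense (dense_finiteSum (D := fun _ => ⊤)
      fun _ => dense_univ) fun ψ hψ => ?_
    induction hψ using finiteSum_induction with
    | zero => simpa only [map_zero] using continuous_const
    | add ψ φ _ _ hψ hφ => simpa only [map_add] using hψ.fun_add hφ
    | single k x _ =>
      simp only [directSumUnitary_single]
      exact (lp.singleContinuousLinearMap ℂ E 2 k).continuous.comp ((hU k).continuous x)

lemma directSumUnitary_mem_finiteSum {W : ∀ k, E k ≃ₗᵢ[ℂ] E k} (hW : ∀ k, ∀ x ∈ D k, W k x ∈ D k)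
    {ψ : lp E 2} (hψ : ψ ∈ finiteSum D) : directSumUnitary W ψ ∈ finiteSum D := by
  induction hψ using finiteSum_induction with
  | zero => simp only [map_zero, Submodule.zero_mem]
  | add ψ φ _ _ hψ hφ => simpa only [map_add] using (finiteSum D).add_mem hψ hφ
  | single k x hx =>
    rw [directSumUnitary_single]
    exact single_mem_finiteSum (hW k x hx)

theorem Integrates.directSum {d : ℕ} {U : ∀ k, (Fin d → ℝ) → (E k ≃ₗᵢ[ℂ] E k)}
    {X : ∀ k, Fin d → (E k →ₗ.[ℂ] E k)} (h : ∀ k, Integrates (U k) (X k) (D k)) :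
    Integrates (fun p => directSumUnitary fun k => U k p) (fun μ => directSumOp fun k => X k μ)
      (finiteSum D) where
  rep := isUnitaryRep_directSumUnitary fun k => (h k).rep
  dense := dense_finiteSum fun k => (h k).dense
  mapsTo p ψ := directSumUnitary_mem_finiteSum fun k => (h k).mapsTo p
  exists_generatesAt ψ hψ := by
    induction hψ using finiteSum_induction with
    | zero =>
      refine ⟨0, fun μ => ⟨Submodule.zero_mem _, Submodule.zero_mem _⟩, fun p => ?_⟩
      simpa using generatesAt_zero _
    | add ψ ψ' _ _ hψ hψ' =>
      obtain ⟨φ, hφ, hgen⟩ := hψ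
      obtain ⟨φ', hφ', hgen'⟩ := hψ'
      refine ⟨φ + φ', fun μ => ⟨Submodule.add_mem _ (hφ μ).1 (hφ' μ).1,
        Submodule.add_mem _ (hφ μ).2 (hφ' μ).2⟩, fun p => ?_⟩
      simpa only [Pi.add_apply, smul_add, Finset.sum_add_distrib] using (hgen p).add (hgen' p)
    | single k x hx =>
      obtain ⟨φ, hφ, hgen⟩ := (h k).exists_generatesAt x hx
      refine ⟨fun μ => lp.single 2 k (φ μ), fun μ => ⟨single_mem_finiteSum (hφ μ).1,
        single_mem_graph_directSumOp (A := fun k => X k μ) (hφ μ).2⟩, fun p => ?_⟩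
      simpa only [map_sum, map_smul, lp.singleContinuousLinearMap_apply] using
        (hgen p).map (lp.singleContinuousLinearMap ℂ E 2 k)
          fun t => directSumUnitary_single (fun k => U k (t • p)) k x

end DirectSum

/-! ### Multiplication operators -/

section Multiplication

lemma norm_inv_mul_exp_sub_one_le (t b : ℝ) :
    ‖(t : ℂ)⁻¹ * (Complex.exp (Complex.I * (t * b : ℝ)) - 1)‖ ≤ |b| := by
  rcases eq_or_ne t 0 with rfl | ht
  · simp
  · rw [norm_mul, norm_inv, Complex.norm_real, inv_mul_le_iff₀ (norm_pos_iff.2 ht),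
      Real.norm_eq_abs, ← abs_mul, ← Real.norm_eq_abs]
    exact Real.norm_exp_I_mul_ofReal_sub_one_le

lemma tendsto_inv_mul_exp_sub_one (b : ℝ) :
    Tendsto (fun t : ℝ => (t : ℂ)⁻¹ * (Complex.exp (Complex.I * (t * b : ℝ)) - 1)) (𝓝[≠] 0)
      (𝓝 (Complex.I * b)) := by
  have hexponent : HasDerivAt (fun t : ℝ => Complex.I * ((t * b : ℝ) : ℂ)) (Complex.I * b) 0 := by
    simpa using (((hasDerivAt_id (0 : ℝ)).mul_const b).ofReal_comp).const_mul Complex.I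
  simpa using hasDerivAt_iff_tendsto_slope_zero.1 hexponent.cexp

variable {α : Type*} [MeasurableSpace α] {ν : Measure α}

lemma tendsto_zero_of_dominated {ι E : Type*} [NormedAddCommGroup E] {q : ℝ≥0∞} [Fact (1 ≤ q)]
    (hq : q ≠ ∞) {l : Filter ι} [l.IsCountablyGenerated] {g : ι → Lp E q ν} {F : ι → α → E}
    {G : α → ℝ} (hg : ∀ i, g i =ᵐ[ν] F i) (hG : MemLp G q ν) (hbound : ∀ i x, ‖F i x‖ ≤ G x)
    (hlim : ∀ x, Tendsto (fun i => F i x) l (𝓝 0)) : Tendsto g l (𝓝 0) := by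
  have hq_pos : 0 < q.toReal := ENNReal.toReal_pos (zero_lt_one.trans_le Fact.out).ne' hq
  have henorm : ∀ i, ‖g i‖ₑ = (∫⁻ x, ‖F i x‖ₑ ^ q.toReal ∂ν) ^ (1 / q.toReal) := fun i => by
    rw [Lp.enorm_def, eLpNorm_congr_ae (hg i),
      eLpNorm_eq_lintegral_rpow_enorm_toReal (zero_lt_one.trans_le Fact.out).ne' hq]
  have hlintegral : Tendsto (fun i => ∫⁻ x, ‖F i x‖ₑ ^ q.toReal ∂ν) l (𝓝 (∫⁻ _, 0 ∂ν)) := by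
    refine tendsto_lintegral_filter_of_dominated_convergence' (fun x => ‖G x‖ₑ ^ q.toReal)
      (Eventually.of_forall fun i => ?_) (Eventually.of_forall fun i => ae_of_all _ fun x => ?_)
      (lintegral_rpow_enorm_lt_top_of_eLpNorm_lt_top
        (zero_lt_one.trans_le Fact.out).ne' hq hG.2).ne (ae_of_all _ fun x => ?_)
    · exact ((Lp.aestronglyMeasurable (g i)).congr (hg i)).enorm.pow_const _
    · gcongr
      exact enorm_le_iff_norm_le.2 ((hbound i x).trans (le_abs_self _))
    · simpa [ENNReal.zero_rpow_of_pos hq_pos] using (hlim x).enorm.ennrpow_const q.toReal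
  rw [tendsto_zero_iff_enorm_tendsto_zero]
  simpa [henorm, ENNReal.zero_rpow_of_pos, hq_pos] using hlintegral.ennrpow_const (1 / q.toReal)

lemma memLp_phase {θ : α → ℝ} (hθ : Measurable θ) (f : Lp ℂ 2 ν) :
    MemLp (fun x => Complex.exp (Complex.I * θ x) * f x) 2 ν := by
  refine (Lp.memLp f).of_le ?_ (ae_of_all _ fun x => ?_)
  · exact (Measurable.aestronglyMeasurable (by fun_prop)).mul (Lp.aestronglyMeasurable f)
  · rw [norm_mul, Complex.norm_exp_I_mul_ofReal, one_mul]

/-- Multiplication by the phase `exp (i θ)`, as a map of `L²` into itself; `phaseMul` upgrades it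
to a unitary operator. -/
def phaseFun (θ : α → ℝ) (hθ : Measurable θ) (f : Lp ℂ 2 ν) : Lp ℂ 2 ν :=
  (memLp_phase hθ f).toLp _

lemma coeFn_phaseFun {θ : α → ℝ} (hθ : Measurable θ) (f : Lp ℂ 2 ν) :
    phaseFun θ hθ f =ᵐ[ν] fun x => Complex.exp (Complex.I * θ x) * f x :=
  MemLp.coeFn_toLp _

lemma phaseFun_zero (f : Lp ℂ 2 ν) : phaseFun (fun _ => 0) measurable_const f = f := by
  refine Lp.ext ?_
  filter_upwards [coeFn_phaseFun measurable_const f] with x hx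
  rw [hx, Complex.ofReal_zero, mul_zero, Complex.exp_zero, one_mul]

lemma phaseFun_add {θ η : α → ℝ} (hθ : Measurable θ) (hη : Measurable η) (f : Lp ℂ 2 ν) :
    phaseFun (fun x => θ x + η x) (hθ.fun_add hη) f = phaseFun θ hθ (phaseFun η hη f) := by
  refine Lp.ext ?_
  filter_upwards [coeFn_phaseFun (hθ.fun_add hη) f, coeFn_phaseFun hθ (phaseFun η hη f),
    coeFn_phaseFun hη f] with x hsum hθx hηx
  rw [hsum, hθx, hηx, Complex.ofReal_add, mul_add, Complex.exp_add, mul_assoc]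

/-- Multiplication by the phase `exp (i θ)` as a unitary operator on `L²`: it is the exponential
of the multiplication operator `mulOp ν θ`. -/
def phaseMul (θ : α → ℝ) (hθ : Measurable θ) : Lp ℂ 2 ν ≃ₗᵢ[ℂ] Lp ℂ 2 ν where
  toFun := phaseFun θ hθ
  invFun := phaseFun (fun x => -θ x) hθ.neg
  left_inv f := by
    rw [← phaseFun_add]
    simp only [neg_add_cancel, phaseFun_zero]
  right_inv f := by
    rw [← phaseFun_add]
    simp only [add_neg_cancel, phaseFun_zero]
  map_add' f g := by
    refine Lp.ext ?_
    filter_upwards [coeFn_phaseFun hθ (f + g), coeFn_phaseFun hθ f, coeFn_phaseFun hθ g,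
      Lp.coeFn_add f g, Lp.coeFn_add (phaseFun θ hθ f) (phaseFun θ hθ g)]
      with x hfg hf hg hadd hadd'
    rw [hfg, hadd, hadd', Pi.add_apply, Pi.add_apply, hf, hg, mul_add]
  map_smul' c f := by
    refine Lp.ext ?_
    filter_upwards [coeFn_phaseFun hθ (c • f), coeFn_phaseFun hθ f, Lp.coeFn_smul c f,
      Lp.coeFn_smul c (phaseFun θ hθ f)] with x hcf hf hsmul hsmul'
    rw [RingHom.id_apply, hcf, hsmul, hsmul', Pi.smul_apply, Pi.smul_apply, hf, mul_smul_comm]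
  norm_map' f := by
    rw [Lp.norm_def, Lp.norm_def]
    refine congrArg ENNReal.toReal (eLpNorm_congr_norm_ae ?_)
    filter_upwards [coeFn_phaseFun hθ f] with x hx
    exact (congrArg norm hx).trans (by rw [norm_mul, Complex.norm_exp_I_mul_ofReal, one_mul])

lemma coeFn_phaseMul {θ : α → ℝ} (hθ : Measurable θ) (f : Lp ℂ 2 ν) :
    phaseMul θ hθ f =ᵐ[ν] fun x => Complex.exp (Complex.I * θ x) * f x :=
  coeFn_phaseFun hθ f

lemma continuous_phaseMul {Y : Type*} [TopologicalSpace Y] [FirstCountableTopology Y]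
    {θ : Y → α → ℝ} (hθ : ∀ y, Measurable (θ y)) (hcont : ∀ x, Continuous fun y => θ y x)
    (f : Lp ℂ 2 ν) : Continuous fun y => phaseMul (θ y) (hθ y) f := by
  refine continuous_iff_continuousAt.2 fun z => tendsto_sub_nhds_zero_iff.1 ?_
  refine tendsto_zero_of_dominated ENNReal.ofNat_ne_top
    (F := fun y x => Complex.exp (Complex.I * θ y x) * f x - Complex.exp (Complex.I * θ z x) * f x)
    (fun y => ?_) ((Lp.memLp f).norm.const_mul 2) (fun y x => ?_) (fun x => ?_)
  · exact (Lp.coeFn_sub _ _).trans ((coeFn_phaseMul (hθ y) f).sub (coeFn_phaseMul (hθ z) f))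
  · refine (norm_sub_le _ _).trans_eq ?_
    rw [norm_mul, norm_mul, Complex.norm_exp_I_mul_ofReal, Complex.norm_exp_I_mul_ofReal, one_mul,
      two_mul]
  · have hphase : Continuous fun y => Complex.exp (Complex.I * θ y x) * f x := by
      have := hcont x
      fun_prop
    exact tendsto_sub_nhds_zero_iff.2 (hphase.tendsto z)

lemma mem_graph_mulOp_iff {a : α → ℝ} {f g : Lp ℂ 2 ν} :
    (f, g) ∈ (mulOp ν a).graph ↔ g =ᵐ[ν] fun x => (a x : ℂ) * f x := by
  constructor
  · intro h
    obtain ⟨x, rfl, rfl⟩ := (LinearPMap.mem_graph_iff _).1 h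
    exact MemLp.coeFn_toLp x.2
  · intro h
    have hf : MemLp (fun x => (a x : ℂ) * f x) 2 ν := (Lp.memLp g).ae_eq h
    exact (LinearPMap.mem_graph_iff _).2
      ⟨⟨f, hf⟩, rfl, Lp.ext ((MemLp.coeFn_toLp hf).trans h.symm)⟩

lemma generatesAt_phaseMul {b : α → ℝ} (hb : Measurable b) {f g : Lp ℂ 2 ν}
    (hg : g =ᵐ[ν] fun x => (b x : ℂ) * f x) :
    GeneratesAt (fun t : ℝ => phaseMul (ν := ν) (fun x => t * b x) (hb.const_mul t)) f g := by
  rw [GeneratesAt, ← tendsto_sub_nhds_zero_iff]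
  refine tendsto_zero_of_dominated ENNReal.ofNat_ne_top
    (F := fun t x => ((t : ℂ)⁻¹ * (Complex.exp (Complex.I * (t * b x : ℝ)) - 1) -
      Complex.I * b x) * f x)
    (fun t => ?_) (((Lp.memLp g).ae_eq hg).norm.const_mul 2) (fun t x => ?_) (fun x => ?_)
  · set U := phaseMul (ν := ν) (fun x => t * b x) (hb.const_mul t)
    filter_upwards [coeFn_phaseMul (hb.const_mul t) f, hg, Lp.coeFn_sub (U f) f,
      Lp.coeFn_smul (t : ℂ)⁻¹ (U f - f), Lp.coeFn_smul Complex.I g,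
      Lp.coeFn_sub ((t : ℂ)⁻¹ • (U f - f)) (Complex.I • g)] with x hU hg hdiff hquot hIg hsub
    rw [hsub, Pi.sub_apply, hquot, hIg, Pi.smul_apply, Pi.smul_apply, hdiff, Pi.sub_apply, hU, hg,
      smul_eq_mul, smul_eq_mul]
    ring
  · rw [norm_mul, norm_mul, Complex.norm_real, Real.norm_eq_abs, ← mul_assoc]
    gcongr
    refine (norm_sub_le _ _).trans ?_
    rw [norm_mul Complex.I, Complex.norm_I, one_mul, Complex.norm_real, Real.norm_eq_abs, two_mul]
    gcongr
    exact norm_inv_mul_exp_sub_one_le t (b x)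
  · simpa using (tendsto_sub_nhds_zero_iff.2 (tendsto_inv_mul_exp_sub_one (b x))).mul_const (f x)

lemma measurable_sum_mul {d : ℕ} {a : Fin d → α → ℝ} (ha : ∀ μ, Measurable (a μ))
    (p : Fin d → ℝ) : Measurable fun x => ∑ μ, p μ * a μ x :=
  Finset.measurable_fun_sum _ fun μ _ => (ha μ).const_mul _

lemma isUnitaryRep_phaseMul {d : ℕ} {a : Fin d → α → ℝ} (ha : ∀ μ, Measurable (a μ)) :
    IsUnitaryRep fun p : Fin d → ℝ =>
      phaseMul (ν := ν) (fun x => ∑ μ, p μ * a μ x) (measurable_sum_mul ha p) where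
  map_zero := by
    ext1 f
    simp only [Pi.zero_apply, zero_mul, Finset.sum_const_zero]
    exact phaseFun_zero f
  map_add p q := by
    ext1 f
    simp only [Pi.add_apply, add_mul, Finset.sum_add_distrib]
    exact phaseFun_add (measurable_sum_mul ha p) (measurable_sum_mul ha q) f
  continuous f := continuous_phaseMul _ (fun x => by fun_prop) f

lemma coeFn_sum_smul_of_mem_graph_mulOp {d : ℕ} {a : Fin d → α → ℝ} {f : Lp ℂ 2 ν}
    {g : Fin d → Lp ℂ 2 ν} (hg : ∀ μ, (f, g μ) ∈ (mulOp ν (a μ)).graph) (p : Fin d → ℝ) :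
    (∑ μ, (p μ : ℂ) • g μ : Lp ℂ 2 ν) =ᵐ[ν] fun x => ((∑ μ, p μ * a μ x : ℝ) : ℂ) * f x := by
  have hmul : ∀ᵐ x ∂ν, ∀ μ, g μ x = (a μ x : ℂ) * f x :=
    ae_all_iff.2 fun μ => mem_graph_mulOp_iff.1 (hg μ)
  have hsmul : ∀ᵐ x ∂ν, ∀ μ, ((p μ : ℂ) • g μ) x = (p μ : ℂ) * g μ x :=
    ae_all_iff.2 fun μ => Lp.coeFn_smul _ _
  filter_upwards [hmul, hsmul, Lp.coeFn_finsetSum (s := Finset.univ) fun μ => (p μ : ℂ) • g μ]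
    with x hmul hsmul hsum
  simp only [hsum, Finset.sum_apply, hsmul, hmul, Complex.ofReal_sum, Complex.ofReal_mul,
    Finset.sum_mul, mul_assoc]

theorem integrates_phaseMul {d : ℕ} {a : Fin d → α → ℝ} (ha : ∀ μ, Measurable (a μ))
    {D : Submodule ℂ (Lp ℂ 2 ν)} (hdense : Dense (D : Set (Lp ℂ 2 ν)))
    (hphase : ∀ p, ∀ f ∈ D, phaseMul (fun x => ∑ μ, p μ * a μ x) (measurable_sum_mul ha p) f ∈ D)
    (hmul : ∀ μ, ∀ f ∈ D, ∃ g ∈ D, (f, g) ∈ (mulOp ν (a μ)).graph) :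
    Integrates (fun p => phaseMul (fun x => ∑ μ, p μ * a μ x) (measurable_sum_mul ha p))
      (fun μ => mulOp ν (a μ)) D where
  rep := isUnitaryRep_phaseMul ha
  dense := hdense
  mapsTo := hphase
  exists_generatesAt f hf := by
    choose g hgD hg using fun μ => hmul μ f hf
    refine ⟨g, fun μ => ⟨hgD μ, hg μ⟩, fun p => ?_⟩
    simpa only [Pi.smul_apply, smul_eq_mul, mul_assoc, Finset.mul_sum] using
      generatesAt_phaseMul (measurable_sum_mul ha p) (coeFn_sum_smul_of_mem_graph_mulOp hg p)

end Multiplication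

/-! ### Elementary tensors -/

section Tensors

variable {α : Type*} [MeasurableSpace α] {ν : Measure α} [SigmaFinite ν] {k : ℕ}

lemma coeFn_tensor (f : Fin k → Lp ℂ 2 ν) :
    tensor f =ᵐ[Measure.pi fun _ : Fin k => ν] fun x => ∏ i, f i (x i) :=
  MemLp.coeFn_toLp _

lemma ae_pi_of_forall_ae {P : Fin k → α → Prop} (h : ∀ i, ∀ᵐ x ∂ν, P i x) :
    ∀ᵐ x ∂(Measure.pi fun _ : Fin k => ν), ∀ i, P i (x i) :=
  ae_all_iff.2 fun i => (Measure.quasiMeasurePreserving_eval (fun _ : Fin k => ν) i).ae (h i)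

lemma norm_tensor (f : Fin k → Lp ℂ 2 ν) : ‖tensor f‖ = ∏ i, ‖f i‖ := by
  have hsq := inner_tensor f f
  simp only [inner_self_eq_norm_sq_to_K] at hsq
  refine (sq_eq_sq₀ (norm_nonneg _) (Finset.prod_nonneg fun _ _ => norm_nonneg _)).1 ?_
  rw [← Finset.prod_pow]
  exact_mod_cast hsq

lemma coeFn_tensor_update (f : Fin k → Lp ℂ 2 ν) (i : Fin k) (g : Lp ℂ 2 ν) :
    tensor (Function.update f i g) =ᵐ[Measure.pi fun _ : Fin k => ν]
      fun x => g (x i) * ∏ j ∈ Finset.univ.erase i, f j (x j) := by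
  filter_upwards [coeFn_tensor (Function.update f i g)] with x hx
  rw [hx, ← Finset.mul_prod_erase _ _ (Finset.mem_univ i), Function.update_self]
  congr 1
  exact Finset.prod_congr rfl fun j hj => by
    rw [Function.update_of_ne (Finset.ne_of_mem_erase hj)]

variable (ν k) in
/-- The elementary tensor `f₁ ⊗ ⋯ ⊗ f_k` as a multilinear map of `f₁, …, f_k`. -/
def tensorMultilinear : MultilinearMap ℂ (fun _ : Fin k => Lp ℂ 2 ν) (TensorPow ν k) where
  toFun := tensor
  map_update_add' {hdec} f i g g' := by
    obtain rfl : hdec = instDecidableEqFin k := Subsingleton.elim _ _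
    refine Lp.ext ?_
    filter_upwards [coeFn_tensor_update f i (g + g'), coeFn_tensor_update f i g,
      coeFn_tensor_update f i g', Lp.coeFn_add (tensor (Function.update f i g))
        (tensor (Function.update f i g')), ae_pi_of_forall_ae fun _ : Fin k => Lp.coeFn_add g g']
      with x hsum hg hg' hadd hadd'
    rw [hadd, hsum, Pi.add_apply, hg, hg', hadd', Pi.add_apply, add_mul]
  map_update_smul' {hdec} f i c g := by
    obtain rfl : hdec = instDecidableEqFin k := Subsingleton.elim _ _
    refine Lp.ext ?_
    filter_upwards [coeFn_tensor_update f i (c • g), coeFn_tensor_update f i g,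
      Lp.coeFn_smul c (tensor (Function.update f i g)),
      ae_pi_of_forall_ae fun _ : Fin k => Lp.coeFn_smul c g] with x hcg hg hsmul hsmul'
    rw [hsmul, hcg, Pi.smul_apply, hg, hsmul', Pi.smul_apply, smul_mul_assoc]

lemma continuous_tensor : Continuous (tensor : (Fin k → Lp ℂ 2 ν) → TensorPow ν k) :=
  ((tensorMultilinear ν k).mkContinuous 1 fun f => by
    rw [one_mul]
    exact (norm_tensor f).le).cont

lemma dense_span_tensor {D : Submodule ℂ (Lp ℂ 2 ν)} (hD : Dense (D : Set (Lp ℂ 2 ν))) :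
    Dense (Submodule.span ℂ {ψ : TensorPow ν k | ∃ f : Fin k → Lp ℂ 2 ν,
      (∀ i, f i ∈ D) ∧ ψ = tensor f} : Set (TensorPow ν k)) := by
  rw [Submodule.dense_iff_topologicalClosure_eq_top, Submodule.topologicalClosure_eq_top_iff,
    Submodule.eq_bot_iff]
  intro h hh
  have hdense : Dense (Set.univ.pi fun _ : Fin k => (D : Set (Lp ℂ 2 ν))) :=
    dense_pi _ fun _ _ => hD
  refine eq_zero_of_inner_tensor fun f => hdense.induction (P := fun f => ⟪tensor f, h⟫_ℂ = 0)
    (fun g hg => ?_) (isClosed_eq (continuous_tensor.inner continuous_const) continuous_const) f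
  exact (Submodule.mem_orthogonal _ _).1 hh _
    (Submodule.subset_span ⟨g, fun i => hg i (Set.mem_univ i), rfl⟩)

lemma phaseMul_tensor {θ : α → ℝ} (hθ : Measurable θ)
    (hsum : Measurable fun x : Fin k → α => ∑ j, θ (x j)) (f : Fin k → Lp ℂ 2 ν) :
    phaseMul (fun x => ∑ j, θ (x j)) hsum (tensor f) = tensor fun i => phaseMul θ hθ (f i) := by
  refine Lp.ext ?_
  filter_upwards [coeFn_phaseMul hsum (tensor f), coeFn_tensor f,
    coeFn_tensor fun i => phaseMul θ hθ (f i), ae_pi_of_forall_ae fun i => coeFn_phaseMul hθ (f i)]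
    with x hphase htensor htensor' hphase'
  simp only [hphase, htensor, htensor', hphase', Finset.prod_mul_distrib, ← Complex.exp_sum,
    Complex.ofReal_sum, Finset.mul_sum]

lemma ext_tensor {F : Type*} [NormedAddCommGroup F] [NormedSpace ℂ F]
    {B C : TensorPow ν k →L[ℂ] F} (h : ∀ f, B (tensor f) = C (tensor f)) : B = C := by
  refine ContinuousLinearMap.ext_on (s := Set.range tensor) ?_ (Set.forall_mem_range.2 h)
  rw [← Finsupp.range_linearCombination]
  exact denseRange_tensor

end Tensors

/-! ### The one-particle domain -/

section OneParticle

variable {n : ℕ} {m : ℝ}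

lemma measurable_energy : Measurable (energy (n := n) m) := by
  unfold energy
  fun_prop

lemma norm_le_energy (p : EuclideanSpace ℝ (Fin n)) : ‖p‖ ≤ energy m p :=
  Real.le_sqrt_of_sq_le (le_add_of_nonneg_right (sq_nonneg m))

lemma energy_le (p : EuclideanSpace ℝ (Fin n)) : energy m p ≤ ‖p‖ + |m| := by
  refine Real.sqrt_le_iff.2 ⟨by positivity, ?_⟩
  rw [add_sq, sq_abs]
  linarith [mul_nonneg (norm_nonneg p) (abs_nonneg m)]

lemma measurable_fourMomentum (μ : Fin (n + 1)) :
    Measurable fun p : EuclideanSpace ℝ (Fin n) => fourMomentum m p μ := by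
  cases μ using Fin.cases with
  | zero => exact measurable_energy
  | succ j =>
    simp only [fourMomentum, Fin.cons_succ]
    fun_prop

lemma abs_fourMomentum_le (p : EuclideanSpace ℝ (Fin n)) (μ : Fin (n + 1)) :
    |fourMomentum m p μ| ≤ ‖p‖ + |m| := by
  cases μ using Fin.cases with
  | zero => exact (abs_of_nonneg (Real.sqrt_nonneg _)).trans_le (energy_le p)
  | succ j => exact (PiLp.norm_apply_le p j).trans (le_add_of_nonneg_right (abs_nonneg m))

lemma restrict_shellMeasure_le :
    (shellMeasure n m).restrict {p | 1 < ‖p‖} ≤ volume := by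
  have hs : MeasurableSet {p : EuclideanSpace ℝ (Fin n) | 1 < ‖p‖} :=
    measurableSet_lt measurable_const measurable_norm
  rw [shellMeasure, restrict_withDensity hs]
  calc (volume.restrict {p | 1 < ‖p‖}).withDensity (fun p => ENNReal.ofReal ((2 * energy m p)⁻¹))
      ≤ (volume.restrict {p | 1 < ‖p‖}).withDensity 1 := by
        refine withDensity_mono ((ae_restrict_iff' hs).2 (ae_of_all _ fun p hp => ?_))
        have henergy : 1 ≤ 2 * energy m p := by
          have hp : 1 < ‖p‖ := hp
          linarith [norm_le_energy (m := m) p]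
        exact ENNReal.ofReal_le_one.2 (inv_le_one_of_one_le₀ henergy)
    _ = volume.restrict {p | 1 < ‖p‖} := withDensity_one
    _ ≤ volume := Measure.restrict_le_self

lemma memLp_inv_one_add_norm_sq_pow :
    MemLp (fun p : EuclideanSpace ℝ (Fin n) => ((1 + ‖p‖ ^ 2) ^ (n + 1))⁻¹) 2 := by
  refine (memLp_two_iff_integrable_sq (by fun_prop)).2 ?_
  have hdim : (Module.finrank ℝ (EuclideanSpace ℝ (Fin n)) : ℝ) < 4 * (n + 1) := by
    rw [finrank_euclideanSpace, Fintype.card_fin]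
    linarith [n.cast_nonneg (α := ℝ)]
  refine (integrable_rpow_neg_one_add_norm_sq hdim).congr (ae_of_all _ fun p => ?_)
  have hexponent : (-(4 * (n + 1) : ℝ) / 2) = -(((n + 1) * 2 : ℕ) : ℝ) := by push_cast; ring
  simp only [hexponent, Real.rpow_neg (show (0 : ℝ) ≤ 1 + ‖p‖ ^ 2 by positivity),
    Real.rpow_natCast, pow_mul, inv_pow]

lemma mem_deltaP_iff {f : OneParticle n m} : f ∈ deltaP n m ↔
    ∀ r : ℕ, ∃ c : ℝ, ∀ᵐ p ∂(shellMeasure n m), ‖p‖ ^ (2 * r) * ‖f p‖ ≤ c := by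
  refine forall_congr' fun r => exists_congr fun c => ?_
  simp [pow_mul]

lemma mul_le_mul_inv_one_add_sq_pow {x y b c C : ℝ} {N : ℕ} (hx : 1 < x) (hy : 0 ≤ y)
    (hC : 0 ≤ C) (hb : b ≤ x + C) (hc : x ^ (2 * (N + 1)) * y ≤ c) :
    b * y ≤ 2 ^ N * (1 + C) * c * ((1 + x ^ 2) ^ N)⁻¹ := by
  have hbx : b ≤ (1 + C) * x ^ 2 := by
    nlinarith [mul_nonneg hC (show 0 ≤ x ^ 2 - 1 by nlinarith)]
  have hsq : 1 + x ^ 2 ≤ 2 * x ^ 2 := by nlinarith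
  refine (le_mul_inv_iff₀ (by positivity)).2 ?_
  calc b * y * (1 + x ^ 2) ^ N
      ≤ ((1 + C) * x ^ 2) * y * (2 * x ^ 2) ^ N := by gcongr
    _ = 2 ^ N * (1 + C) * (x ^ (2 * (N + 1)) * y) := by rw [mul_pow, ← pow_mul]; ring
    _ ≤ 2 ^ N * (1 + C) * c := by gcongr

variable {b : EuclideanSpace ℝ (Fin n) → ℝ} {C : ℝ} {f : OneParticle n m}

lemma memLp_mul_of_mem_deltaP (hb : Measurable b) (hbound : ∀ p, |b p| ≤ ‖p‖ + C)
    (hf : f ∈ deltaP n m) : MemLp (fun p => (b p : ℂ) * f p) 2 (shellMeasure n m) := by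
  classical
  have hC : 0 ≤ C := by simpa using (abs_nonneg _).trans (hbound 0)
  have hs : MeasurableSet {p : EuclideanSpace ℝ (Fin n) | 1 < ‖p‖} :=
    measurableSet_lt measurable_const measurable_norm
  have hmeas : AEStronglyMeasurable (fun p => (b p : ℂ) * f p) (shellMeasure n m) :=
    (Measurable.aestronglyMeasurable (by fun_prop)).mul (Lp.aestronglyMeasurable f)
  have hnorm : ∀ p, ‖(b p : ℂ) * f p‖ = |b p| * ‖f p‖ := fun p => by
    rw [norm_mul, Complex.norm_real, Real.norm_eq_abs]
  obtain ⟨c, hc⟩ := mem_deltaP_iff.1 hf (n + 2)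
  -- For `m = 0` the density `1 / (2 ω)` is singular at the origin, so the decay of `f` is compared
  -- with Lebesgue measure only for `1 < ‖p‖`, and elsewhere `b` is bounded.
  rw [← Set.piecewise_same {p | 1 < ‖p‖} fun p => (b p : ℂ) * f p]
  refine MemLp.piecewise hs ?_ ?_
  · have hdecay :=
      memLp_inv_one_add_norm_sq_pow.mono_measure (restrict_shellMeasure_le (n := n) (m := m))
    refine (hdecay.const_mul (2 ^ (n + 1) * (1 + C) * c)).mono' hmeas.restrict ?_
    filter_upwards [ae_restrict_of_ae hc, ae_restrict_mem hs] with p hc hp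
    rw [hnorm]
    exact mul_le_mul_inv_one_add_sq_pow hp (norm_nonneg _) hC (hbound p) hc
  · refine (((Lp.memLp f).restrict _).norm.const_mul (1 + C)).mono' hmeas.restrict ?_
    filter_upwards [ae_restrict_mem hs.compl] with p hp
    rw [hnorm]
    gcongr
    linarith [hbound p, not_lt.1 (Set.notMem_ofPred_iff.1 hp)]

lemma exists_mem_deltaP_mem_graph_mulOp (hb : Measurable b) (hbound : ∀ p, |b p| ≤ ‖p‖ + C)
    (hf : f ∈ deltaP n m) : ∃ g ∈ deltaP n m, (f, g) ∈ (mulOp (shellMeasure n m) b).graph := by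
  have hC : 0 ≤ C := by simpa using (abs_nonneg _).trans (hbound 0)
  have hcoe := MemLp.coeFn_toLp (memLp_mul_of_mem_deltaP hb hbound hf)
  refine ⟨_, mem_deltaP_iff.2 fun r => ?_, mem_graph_mulOp_iff.2 hcoe⟩
  obtain ⟨c, hc⟩ := mem_deltaP_iff.1 hf r
  obtain ⟨c', hc'⟩ := mem_deltaP_iff.1 hf (r + 1)
  refine ⟨(1 + C) * c + c', ?_⟩
  filter_upwards [hc, hc', hcoe] with p hc hc' hcoe
  have hb_le : |b p| ≤ (1 + C) + ‖p‖ ^ 2 := by nlinarith [hbound p, sq_nonneg (‖p‖ - 1)]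
  rw [hcoe, norm_mul, Complex.norm_real, Real.norm_eq_abs]
  calc ‖p‖ ^ (2 * r) * (|b p| * ‖f p‖)
      ≤ ‖p‖ ^ (2 * r) * (((1 + C) + ‖p‖ ^ 2) * ‖f p‖) := by gcongr
    _ = (1 + C) * (‖p‖ ^ (2 * r) * ‖f p‖) + ‖p‖ ^ (2 * (r + 1)) * ‖f p‖ := by ring
    _ ≤ (1 + C) * c + c' := by gcongr

lemma phaseMul_mem_deltaP {θ : EuclideanSpace ℝ (Fin n) → ℝ} (hθ : Measurable θ)
    (hf : f ∈ deltaP n m) : phaseMul θ hθ f ∈ deltaP n m := by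
  refine mem_deltaP_iff.2 fun r => (mem_deltaP_iff.1 hf r).imp fun c hc => ?_
  filter_upwards [hc, coeFn_phaseMul hθ f] with p hc hphase
  rwa [hphase, norm_mul, Complex.norm_exp_I_mul_ofReal, one_mul]

lemma toLp_indicator_mem_deltaP {s : Set (EuclideanSpace ℝ (Fin n))} (hs : MeasurableSet s)
    {R c : ℝ} (hsR : ∀ p ∈ s, ‖p‖ ≤ R) (hsc : ∀ p ∈ s, ‖f p‖ ≤ c) :
    ((Lp.memLp f).indicator hs).toLp _ ∈ deltaP n m := by
  have hmem : MemLp (s.indicator f) 2 (shellMeasure n m) := (Lp.memLp f).indicator hs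
  refine mem_deltaP_iff.2 fun r => ⟨|R| ^ (2 * r) * |c|, ?_⟩
  filter_upwards [MemLp.coeFn_toLp hmem] with p hcoe
  rw [hcoe]
  by_cases hp : p ∈ s
  · rw [Set.indicator_of_mem hp]
    gcongr
    exacts [(hsR p hp).trans (le_abs_self R), (hsc p hp).trans (le_abs_self c)]
  · rw [Set.indicator_of_notMem hp, norm_zero, mul_zero]
    positivity

lemma dense_deltaP : Dense (deltaP n m : Set (OneParticle n m)) := by
  intro f
  let s : ℕ → Set (EuclideanSpace ℝ (Fin n)) := fun N => {p | ‖p‖ ≤ N ∧ ‖f p‖ ≤ N}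
  have hs : ∀ N, MeasurableSet (s N) := fun N =>
    (measurableSet_le measurable_norm measurable_const).inter
      (measurableSet_le (Lp.stronglyMeasurable f).measurable.norm measurable_const)
  let g : ℕ → OneParticle n m := fun N => ((Lp.memLp f).indicator (hs N)).toLp _
  have hg : ∀ N, g N ∈ deltaP n m := fun N =>
    toLp_indicator_mem_deltaP (hs N) (fun _ hp => hp.1) fun _ hp => hp.2
  have hexhaust : ∀ p, ∀ᶠ N : ℕ in atTop, p ∈ s N := fun p =>
    (tendsto_natCast_atTop_atTop.eventually_ge_atTop ‖p‖).and
      (tendsto_natCast_atTop_atTop.eventually_ge_atTop ‖f p‖)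
  have hlim : Tendsto (fun N => g N - f) atTop (𝓝 0) := by
    refine tendsto_zero_of_dominated ENNReal.ofNat_ne_top
      (F := fun N p => (s N).indicator f p - f p) (fun N => ?_) (Lp.memLp f).norm (fun N p => ?_)
      fun p => ?_
    · exact (Lp.coeFn_sub _ _).trans ((MemLp.coeFn_toLp _).sub .rfl)
    · by_cases hp : p ∈ s N <;> simp [hp]
    · refine tendsto_const_nhds.congr' ?_
      filter_upwards [hexhaust p] with N hp
      rw [Set.indicator_of_mem hp, sub_self]
  exact mem_closure_of_tendsto (tendsto_sub_nhds_zero_iff.1 hlim) (Eventually.of_forall hg)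

end OneParticle

/-! ### The `k`-particle space -/

section KParticle

lemma measurable_totalMomentum (n : ℕ) (m : ℝ) (k : ℕ) (μ : Fin (n + 1)) :
    Measurable fun x : Fin k → EuclideanSpace ℝ (Fin n) => ∑ j, fourMomentum m (x j) μ :=
  Finset.measurable_fun_sum _ fun j _ => (measurable_fourMomentum μ).comp (measurable_pi_apply j)

/-- The translation `exp (i p · P)` on the one-particle space. -/
def translationOne (n : ℕ) (m : ℝ) (p : Fin (n + 1) → ℝ) : OneParticle n m ≃ₗᵢ[ℂ] OneParticle n m :=
  phaseMul (fun q => ∑ μ, p μ * fourMomentum m q μ) (measurable_sum_mul measurable_fourMomentum p)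

/-- The translation `exp (i p · P)` on the `k`-particle space. -/
def translationK (n : ℕ) (m : ℝ) (k : ℕ) (p : Fin (n + 1) → ℝ) :
    KParticle n m k ≃ₗᵢ[ℂ] KParticle n m k :=
  phaseMul (fun x => ∑ μ, p μ * ∑ j, fourMomentum m (x j) μ)
    (measurable_sum_mul (measurable_totalMomentum n m k) p)

variable {n : ℕ} {m : ℝ} {k : ℕ}

lemma translationK_tensor (p : Fin (n + 1) → ℝ) (f : Fin k → OneParticle n m) :
    translationK n m k p (tensor f) =
      tensor fun i => translationOne n m p (f i) := by
  simp only [translationK, Finset.mul_sum,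
    Finset.sum_comm (s := Finset.univ (α := Fin (n + 1)))]
  exact phaseMul_tensor (measurable_sum_mul measurable_fourMomentum p) _ f

lemma tensor_mem_deltaKP {f : Fin k → OneParticle n m} (hf : ∀ i, f i ∈ deltaP n m) :
    tensor f ∈ deltaKP n m k :=
  Submodule.subset_span ⟨f, hf, rfl⟩

lemma deltaKP_le {D : Submodule ℂ (KParticle n m k)}
    (h : ∀ f : Fin k → OneParticle n m, (∀ i, f i ∈ deltaP n m) → tensor f ∈ D) :
    deltaKP n m k ≤ D :=
  Submodule.span_le.2 fun _ ⟨f, hf, hψ⟩ => hψ ▸ h f hf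

lemma translationK_mem_deltaKP (p : Fin (n + 1) → ℝ) {ψ : KParticle n m k}
    (hψ : ψ ∈ deltaKP n m k) : translationK n m k p ψ ∈ deltaKP n m k := by
  suffices deltaKP n m k ≤
      (deltaKP n m k).comap (translationK n m k p).toLinearEquiv.toLinearMap from this hψ
  refine deltaKP_le fun f hf => ?_
  change translationK n m k p (tensor f) ∈ deltaKP n m k
  rw [translationK_tensor]
  exact tensor_mem_deltaKP fun i => phaseMul_mem_deltaP _ (hf i)

lemma exists_mem_graph_momentumK_tensor (μ : Fin (n + 1)) {f : Fin k → OneParticle n m}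
    (hf : ∀ i, f i ∈ deltaP n m) :
    ∃ χ ∈ deltaKP n m k, (tensor f, χ) ∈ (momentumK n m k μ).graph := by
  choose g hg hgraph using fun i => exists_mem_deltaP_mem_graph_mulOp
    (measurable_fourMomentum (m := m) μ) (fun p => abs_fourMomentum_le p μ) (hf i)
  choose F hF hval using fun i => (LinearPMap.mem_graph_iff _).1 (hgraph i)
  obtain rfl : (fun i => (F i : OneParticle n m)) = f := funext hF
  refine ⟨_, Submodule.sum_mem _ fun j _ => tensor_mem_deltaKP fun i => ?_,
    mulOp_sum_tensor (fun p => fourMomentum m p μ) F⟩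
  rw [hval]
  rcases eq_or_ne i j with rfl | hij
  · rw [Function.update_self]
    exact hg i
  · rw [Function.update_of_ne hij]
    exact hf i

lemma exists_mem_graph_momentumK (μ : Fin (n + 1)) {ψ : KParticle n m k}
    (hψ : ψ ∈ deltaKP n m k) : ∃ χ ∈ deltaKP n m k, (ψ, χ) ∈ (momentumK n m k μ).graph := by
  let T := (momentumK n m k μ).graph ⊓ Submodule.prod ⊤ (deltaKP n m k)
  have hle : deltaKP n m k ≤ T.map (LinearMap.fst ℂ _ _) := deltaKP_le fun f hf =>
    let ⟨χ, hχ, hgraph⟩ := exists_mem_graph_momentumK_tensor μ hf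
    ⟨(tensor f, χ), ⟨hgraph, trivial, hχ⟩, rfl⟩
  obtain ⟨⟨_, χ⟩, ⟨hgraph, -, hχ⟩, rfl⟩ := hle hψ
  exact ⟨χ, hχ, hgraph⟩

theorem integrates_momentumK (n : ℕ) (m : ℝ) (k : ℕ) :
    Integrates (translationK n m k) (momentumK n m k) (deltaKP n m k) :=
  integrates_phaseMul (measurable_totalMomentum n m k) (dense_span_tensor dense_deltaP)
    (fun p _ => translationK_mem_deltaKP p) fun μ _ => exists_mem_graph_momentumK μ

end KParticle

/-! ### Symmetrization -/

section Symmetrization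

variable {α : Type*} [MeasurableSpace α] {ν : Measure α} [SigmaFinite ν] {k : ℕ}

variable (ν) in
/-- The permutation operator `(σ ψ)(x) = ψ (x ∘ σ)` on the `k`-particle space; the bosonic vectors
are those fixed by all permutations. -/
def permOp (σ : Equiv.Perm (Fin k)) : TensorPow ν k →ₗᵢ[ℂ] TensorPow ν k :=
  Lp.compMeasurePreservingₗᵢ ℂ (E := ℂ) (p := 2) _ (measurePreserving_perm (ν := ν) σ)

lemma coeFn_permOp (σ : Equiv.Perm (Fin k)) (ψ : TensorPow ν k) :
    permOp ν σ ψ =ᵐ[Measure.pi fun _ : Fin k => ν] fun x => ψ (x ∘ σ) :=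
  Lp.coeFn_compMeasurePreserving ψ (measurePreserving_perm (ν := ν) σ)

lemma mem_symmetricSubspace_iff {ψ : TensorPow ν k} :
    ψ ∈ symmetricSubspace ν k ↔ ∀ σ, permOp ν σ ψ = ψ := by
  simp only [symmetricSubspace, Submodule.mem_iInf, LinearMap.mem_ker, LinearMap.sub_apply,
    sub_eq_zero]
  rfl

lemma permOp_tensor (σ : Equiv.Perm (Fin k)) (f : Fin k → Lp ℂ 2 ν) :
    permOp ν σ (tensor f) = tensor fun i => f (σ.symm i) := by
  refine Lp.ext ?_
  filter_upwards [coeFn_permOp σ (tensor f), coeFn_tensor fun i => f (σ.symm i),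
    (measurePreserving_perm (ν := ν) σ).quasiMeasurePreserving.ae (coeFn_tensor f)]
    with x hperm htensor htensor'
  rw [hperm, htensor, htensor']
  exact Fintype.prod_equiv σ _ _ fun i => by rw [Function.comp_apply, σ.symm_apply_apply]

lemma permOp_permOp (σ τ : Equiv.Perm (Fin k)) (ψ : TensorPow ν k) :
    permOp ν σ (permOp ν τ ψ) = permOp ν (σ * τ) ψ := by
  refine DFunLike.congr_fun (ext_tensor (C := (permOp ν (σ * τ)).toContinuousLinearMap)
    (B := (permOp ν σ).toContinuousLinearMap ∘L (permOp ν τ).toContinuousLinearMap)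
    fun f => ?_) ψ
  change permOp ν σ (permOp ν τ (tensor f)) = permOp ν (σ * τ) (tensor f)
  rw [permOp_tensor, permOp_tensor, permOp_tensor]
  rfl

lemma permOp_tensorwise_comm {B : TensorPow ν k ≃ₗᵢ[ℂ] TensorPow ν k} {b : Lp ℂ 2 ν → Lp ℂ 2 ν}
    (hB : ∀ f, B (tensor f) = tensor fun i => b (f i)) (σ : Equiv.Perm (Fin k))
    (ψ : TensorPow ν k) : permOp ν σ (B ψ) = B (permOp ν σ ψ) := by
  let B' : TensorPow ν k →L[ℂ] TensorPow ν k := B.toContinuousLinearEquiv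
  refine DFunLike.congr_fun (ext_tensor (B := (permOp ν σ).toContinuousLinearMap ∘L B')
    (C := B' ∘L (permOp ν σ).toContinuousLinearMap) fun f => ?_) ψ
  change permOp ν σ (B (tensor f)) = B (permOp ν σ (tensor f))
  rw [hB, permOp_tensor, permOp_tensor, hB]

lemma tensorwise_mem_symmetricSubspace {B : TensorPow ν k ≃ₗᵢ[ℂ] TensorPow ν k}
    {b : Lp ℂ 2 ν → Lp ℂ 2 ν} (hB : ∀ f, B (tensor f) = tensor fun i => b (f i))
    {ψ : TensorPow ν k} (hψ : ψ ∈ symmetricSubspace ν k) : B ψ ∈ symmetricSubspace ν k :=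
  mem_symmetricSubspace_iff.2 fun σ => by
    rw [permOp_tensorwise_comm hB, mem_symmetricSubspace_iff.1 hψ]

variable (ν k) in
/-- The symmetrization operator, the average of the permutation operators: it projects onto the
bosonic subspace. -/
def symmetrization : TensorPow ν k →L[ℂ] TensorPow ν k :=
  ((Fintype.card (Equiv.Perm (Fin k)) : ℂ)⁻¹) •
    ∑ σ : Equiv.Perm (Fin k), (permOp ν σ).toContinuousLinearMap

lemma symmetrization_apply (ψ : TensorPow ν k) :
    symmetrization ν k ψ = ((Fintype.card (Equiv.Perm (Fin k)) : ℂ)⁻¹) •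
      ∑ σ : Equiv.Perm (Fin k), permOp ν σ ψ := by
  simp [symmetrization]

lemma symmetrization_mem_symmetricSubspace (ψ : TensorPow ν k) :
    symmetrization ν k ψ ∈ symmetricSubspace ν k := by
  refine mem_symmetricSubspace_iff.2 fun σ => ?_
  simp only [symmetrization_apply, map_smul, map_sum, permOp_permOp]
  congr 1
  exact Fintype.sum_equiv (Equiv.mulLeft σ) _ _ fun τ => rfl

lemma symmetrization_of_mem_symmetricSubspace {ψ : TensorPow ν k}
    (hψ : ψ ∈ symmetricSubspace ν k) : symmetrization ν k ψ = ψ := by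
  rw [symmetrization_apply, Finset.sum_congr rfl fun σ _ => mem_symmetricSubspace_iff.1 hψ σ,
    Finset.sum_const, Finset.card_univ, ← Nat.cast_smul_eq_nsmul ℂ, smul_smul,
    inv_mul_cancel₀ (Nat.cast_ne_zero.2 Fintype.card_ne_zero), one_smul]

lemma dense_comap_symmetricSubspace {D : Submodule ℂ (TensorPow ν k)}
    (hD : Dense (D : Set (TensorPow ν k))) (hperm : ∀ σ, ∀ ψ ∈ D, permOp ν σ ψ ∈ D) :
    Dense (D.comap (symmetricSubspace ν k).subtype : Set (symmetricSubspace ν k)) := by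
  let S : TensorPow ν k → symmetricSubspace ν k := fun ψ =>
    ⟨symmetrization ν k ψ, symmetrization_mem_symmetricSubspace ψ⟩
  have hcont : Continuous S := (symmetrization ν k).continuous.subtype_mk _
  have hsurj : Function.Surjective S := fun ψ =>
    ⟨ψ, Subtype.ext (symmetrization_of_mem_symmetricSubspace ψ.2)⟩
  refine (hsurj.denseRange.dense_image hcont hD).mono ?_
  rintro _ ⟨ψ, hψ, rfl⟩
  change symmetrization ν k ψ ∈ D
  rw [symmetrization_apply]
  exact D.smul_mem _ (D.sum_mem fun σ _ => hperm σ ψ hψ)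

end Symmetrization

/-! ### The operators `X` -/

section OperatorsX

variable {n : ℕ} {m : ℝ} (V : OneParticle n m ≃ₗᵢ[ℂ] OneParticle n m)

/-- The unitary group `exp (i p · X)` on the `k`-particle space. -/
def expK (k : ℕ) (p : Fin (n + 1) → ℝ) : KParticle n m k ≃ₗᵢ[ℂ] KParticle n m k :=
  (tensorPow V k)⁻¹ * translationK n m k p * tensorPow V k

/-- The unitary group `exp (i p · X)` on Fock space. -/
def expFock (p : Fin (n + 1) → ℝ) : Fock n m ≃ₗᵢ[ℂ] Fock n m :=
  (Gam V)⁻¹ * (directSumUnitary fun k => translationK n m k p) * Gam V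

theorem integrates_opXK (k : ℕ) : Integrates (expK V k) (opXK V k) (deltaKX V k) :=
  (integrates_momentumK n m k).sandwich (tensorPow V k)

theorem integrates_opX : Integrates (expFock V) (opX V) (deltaFockX V) :=
  (Integrates.directSum fun k => integrates_momentumK n m k).sandwich (Gam V)

lemma expK_tensor (k : ℕ) (p : Fin (n + 1) → ℝ) (f : Fin k → OneParticle n m) :
    expK V k p (tensor f) = tensor fun i =>
      V.symm (translationOne n m p (V (f i))) := by
  change tensorPow V.symm k (translationK n m k p (tensorPow V k (tensor f))) = _
  rw [tensorPow_tensor, translationK_tensor, tensorPow_tensor]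

lemma expK_mem_symmetricSubspace {k : ℕ} (p : Fin (n + 1) → ℝ) {ψ : KParticle n m k}
    (hψ : ψ ∈ symmetricSubspace (shellMeasure n m) k) :
    expK V k p ψ ∈ symmetricSubspace (shellMeasure n m) k :=
  tensorwise_mem_symmetricSubspace (b := fun f => V.symm (translationOne n m p (V f)))
    (expK_tensor V k p) hψ

lemma permOp_mem_deltaKP {k : ℕ} (σ : Equiv.Perm (Fin k)) {ψ : KParticle n m k}
    (hψ : ψ ∈ deltaKP n m k) : permOp (shellMeasure n m) σ ψ ∈ deltaKP n m k := by
  suffices deltaKP n m k ≤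
      (deltaKP n m k).comap (permOp (shellMeasure n m) σ).toLinearMap from this hψ
  refine deltaKP_le fun f hf => ?_
  change permOp (shellMeasure n m) σ (tensor f) ∈ deltaKP n m k
  rw [permOp_tensor]
  exact tensor_mem_deltaKP fun i => hf _

lemma permOp_mem_deltaKX {k : ℕ} (σ : Equiv.Perm (Fin k)) {ψ : KParticle n m k}
    (hψ : ψ ∈ deltaKX V k) : permOp (shellMeasure n m) σ ψ ∈ deltaKX V k := by
  obtain ⟨χ, hχ, rfl⟩ := hψ
  exact ⟨_, permOp_mem_deltaKP σ hχ, (permOp_tensorwise_comm (tensorPow_tensor V.symm) σ χ).symm⟩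

lemma dense_comap_deltaKX (k : ℕ) :
    Dense ((deltaKX V k).comap (symmetricSubspace (shellMeasure n m) k).subtype :
      Set (symmetricSubspace (shellMeasure n m) k)) :=
  dense_comap_symmetricSubspace (integrates_opXK V k).dense fun σ _ => permOp_mem_deltaKX V σ

lemma mem_bosonicFock_iff {ψ : Fock n m} :
    ψ ∈ bosonicFock n m ↔ ∀ k, ψ k ∈ symmetricSubspace (shellMeasure n m) k := by
  simp only [bosonicFock, componentwise, Submodule.mem_iInf]
  rfl

lemma expFock_mem_bosonicFock (p : Fin (n + 1) → ℝ) {ψ : Fock n m} (hψ : ψ ∈ bosonicFock n m) :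
    expFock V p ψ ∈ bosonicFock n m :=
  mem_bosonicFock_iff.2 fun k => expK_mem_symmetricSubspace V p (mem_bosonicFock_iff.1 hψ k)

lemma single_mem_deltaFockX {k : ℕ} {x : KParticle n m k} (hx : x ∈ deltaKX V k) :
    (lp.single 2 k x : Fock n m) ∈ deltaFockX V := by
  obtain ⟨y, hy, rfl⟩ := hx
  exact ⟨lp.single 2 k y, single_mem_finiteSum hy, directSumUnitary_single _ _ _⟩

lemma single_mem_bosonicFock {k : ℕ} {x : KParticle n m k}
    (hx : x ∈ symmetricSubspace (shellMeasure n m) k) :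
    (lp.single 2 k x : Fock n m) ∈ bosonicFock n m := by
  refine mem_bosonicFock_iff.2 fun j => ?_
  rcases eq_or_ne j k with rfl | hjk
  · rwa [lp.single_apply_self]
  · rw [lp.single_apply_ne _ _ _ hjk]
    exact Submodule.zero_mem _

lemma finiteSum_le_deltaFockX_inf_bosonicFock :
    finiteSum (fun k => deltaKX V k ⊓ symmetricSubspace (shellMeasure n m) k) ≤
      deltaFockX V ⊓ bosonicFock n m := by
  intro ψ hψ
  induction hψ using finiteSum_induction with
  | single k x hx => exact ⟨single_mem_deltaFockX V hx.1, single_mem_bosonicFock hx.2⟩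
  | zero => exact Submodule.zero_mem _
  | add ψ χ _ _ hψ hχ => exact Submodule.add_mem _ hψ hχ

lemma dense_comap_deltaFockX :
    Dense ((deltaFockX V).comap (bosonicFock n m).subtype : Set (bosonicFock n m)) := by
  refine Subtype.dense_iff.2 fun ψ hψ => ?_
  have hcomponent : ∀ k, ψ k ∈
      (deltaKX V k ⊓ symmetricSubspace (shellMeasure n m) k).topologicalClosure := fun k =>
    closure_mono (by rintro _ ⟨χ, hχ, rfl⟩; exact ⟨hχ, χ.2⟩)
      (Subtype.dense_iff.1 (dense_comap_deltaKX V k) (mem_bosonicFock_iff.1 hψ k))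
  refine closure_mono (fun χ hχ => ?_) (mem_topologicalClosure_finiteSum hcomponent)
  obtain ⟨hdelta, hbosonic⟩ := finiteSum_le_deltaFockX_inf_bosonicFock V hχ
  exact ⟨⟨χ, hbosonic⟩, hdelta, rfl⟩

end OperatorsX

end WarpedQFT

end

theorem mainTheorem9 (n : ℕ) (hn : 1 ≤ n) (m : ℝ) (hm : 0 ≤ m)
    (V : OneParticle n m ≃ₗᵢ[ℂ] OneParticle n m) :
    -- on each `k`-particle space, with the domain `Δ_k(X)`
    (∀ k : ℕ, IsCommutingEssSelfAdjoint (opXK V k) (deltaKX V k) ∧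
      GeneratesUnitaryGroup (opXK V k) (deltaKX V k)) ∧
    -- on Fock space, with the finite sums of vectors from the `Δ_k(X)`
    (IsCommutingEssSelfAdjoint (opX V) (deltaFockX V) ∧
      GeneratesUnitaryGroup (opX V) (deltaFockX V)) ∧
    -- on the bosonic `k`-particle spaces
    (∀ k : ℕ,
      IsCommutingEssSelfAdjoint
        (fun μ => part (opXK V k μ) (symmetricSubspace (shellMeasure n m) k))
        ((deltaKX V k).comap (symmetricSubspace (shellMeasure n m) k).subtype) ∧
      GeneratesUnitaryGroup
        (fun μ => part (opXK V k μ) (symmetricSubspace (shellMeasure n m) k))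
        ((deltaKX V k).comap (symmetricSubspace (shellMeasure n m) k).subtype)) ∧
    -- on bosonic Fock space
    (IsCommutingEssSelfAdjoint
        (fun μ => part (opX V μ) (bosonicFock n m))
        ((deltaFockX V).comap (bosonicFock n m).subtype) ∧
      GeneratesUnitaryGroup
        (fun μ => part (opX V μ) (bosonicFock n m))
        ((deltaFockX V).comap (bosonicFock n m).subtype)) := by
  refine ⟨fun k => ?_, ?_, fun k => ?_, ?_⟩
  · exact ⟨(integrates_opXK V k).isCommutingEssSelfAdjoint,
      (integrates_opXK V k).generatesUnitaryGroup⟩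
  · exact ⟨(integrates_opX V).isCommutingEssSelfAdjoint, (integrates_opX V).generatesUnitaryGroup⟩
  · have hbosonic := (integrates_opXK V k).part (fun p _ => expK_mem_symmetricSubspace V p)
      (dense_comap_deltaKX V k)
    exact ⟨hbosonic.isCommutingEssSelfAdjoint, hbosonic.generatesUnitaryGroup⟩
  · have hbosonic := (integrates_opX V).part (fun p _ => expFock_mem_bosonicFock V p)
      (dense_comap_deltaFockX V)
    exact ⟨hbosonic.isCommutingEssSelfAdjoint, hbosonic.generatesUnitaryGroup⟩
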